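/- Let $\mathcal F_2$ be the mod $2$ Leibniz–Hopf algebra: the free associative $\mathbb F_2$-algebra on $S^1,S^2,\dots$ ($|S^i|=i$, $S^0=1$) with coproduct $\Delta(S^n)=\sum_{i=0}^n S^i\otimes S^{n-i}$. Let $\pi:\mathcal F_2\to\mathcal A_2$ be the quotient Hopf algebra by the two-sided ideal generated by the Adem relations $$S^iS^j-\sum_{k=0}^{\lfloor i/2\rfloor}\binom{j-k-1}{i-2k}S^{i+j-k}S^k\qquad(0<i<2j),$$ and put $Sq^i=\pi(S^i)$. For a finite sequence $I=(i_1,\dots,i_n)$ of positive integers write $S^I=S^{i_1}\cdots S^{i_n}$ and $Sq^I=\pi(S^I)$; $I$ is admissible if $i_k\ge 2i_{k+1}$ for all $k<n$. Let $\mathcal F_2^*$, $\mathcal A_2^*$ be the graded duals, with the products dual to the coproducts (on $\mathcal F_2^*$ this is the overlapping shuffle product), and let $\pi^*:\mathcal A_2^*\to\mathcal F_2^*$ be the algebra map dual to $\pi$. Let $\{S_I\}$ be the basis of $\mathcal F_2^*$ dual to $\{S^I\}$. Order sequences right lexicographically: $(a_1,\dots,a_n)>(b_1,\dots,b_m)$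 if $n>m$, or $n=m$ and there is $k$ with $a_k>b_k$ and $a_i=b_i$ for all $i>k$. For an admissible $J=(j_1,\dots,j_n)$ put $\gamma(J)=(j_1-2j_2,\dots,j_{n-1}-2j_n,j_n)$, and for $L=(l_1,\dots,l_n)$ write $x^L=x_1^{l_1}\cdots x_n^{l_n}$. The admissible monomials $Sq^J$ form a basis of $\mathcal A_2$, and $\mathcal A_2^*$ has the dual basis $\{Sq_J\mid J \text{ admissible}\}$. For $n\ge1$ put $\xi_n=Sq_{2^{n-1},2^{n-2},\dots,2^0}\in\mathcal A_2^*$ and $\bar\xi_n=S_{2^{n-1},2^{n-2},\dots,2^0}\in\mathcal F_2^*$. Then: 1. $\pi^*$ is injective, $\pi^*(\xi_n)=\bar\xi_n$ for all $n\ge 1$, and the image of $\pi^*$ is the subalgebra of $\mathcal F_2^*$ generated by $\bar\xi_1,\bar\xi_2,\dots$. The $\bar\xi_n$ are algebraically independent, so that $\mathrm{Im}(\pi^*)=\mathbb F_2[\bar\xi_1,\bar\xi_2,\dots]$. For every admissible $J$, $\bar\xi^{\gamma(J)}-S_J$ is a linear combination of elements $S_I$ with $I>J$. 2. (Milnor)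 $\mathcal A_2^*=\mathbb F_2[\xi_1,\xi_2,\dots]$: the $\xi_n$ generate $\mathcal A_2^*$ as an algebra and are algebraically independent. For every admissible $J$, $\xi^{\gamma(J)}-Sq_J$ is a linear combination of elements $Sq_K$ with $K$ admissible and $K>J$. -/

import Mathlib

namespace Steenrod

/-!
### Auxiliary facts: stability of the Adem relations under Cauchy products

The only purpose of this section is the last theorem, `SatisfiesAdem.conv`, which is
needed to see that the coproduct of the Leibniz--Hopf algebra descends to the Steenrod algebra
(that is, that the ideal generated by the Adem relations is a Hopf ideal).
-/

section Auxiliary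
open Polynomial Finset

/-- `∑ c_i u^i v^{n-i}`. -/
noncomputable def bm (n : ℕ) (c : ℕ → ZMod 2) (u v : (ZMod 2)[X]) : (ZMod 2)[X] :=
  ∑ p ∈ antidiagonal n, C (c p.1) * (u ^ p.1 * v ^ p.2)

/-- The coefficient of `X^a` in `p / (1 + X)^(a+1)`. -/
noncomputable def res (a : ℕ) (p : (ZMod 2)[X]) : ZMod 2 :=
  PowerSeries.coeff a ((p : PowerSeries (ZMod 2)) * (PowerSeries.invOneSubPow (ZMod 2) (a + 1)).val)

theorem res_add (a : ℕ) (p q : (ZMod 2)[X]) : res a (p + q) = res a p + res a q := by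
  simp [res, add_mul]

theorem res_sum {ι : Type} (a : ℕ) (s : Finset ι) (p : ι → (ZMod 2)[X]) :
    res a (∑ i ∈ s, p i) = ∑ i ∈ s, res a (p i) := by
  have : ∀ q, res a q = (AddMonoidHom.mk' (res a) (res_add a)) q := fun q => rfl
  simp only [this, map_sum]

theorem res_C_mul (a : ℕ) (c : ZMod 2) (p : (ZMod 2)[X]) : res a (C c * p) = c * res a p := by
  simp [res, mul_assoc]

theorem one_add_X_eq : ((1 + X : (ZMod 2)[X]) : PowerSeries (ZMod 2)) = 1 - PowerSeries.X := by
  have h2 : (1 + X : (ZMod 2)[X]) = 1 - X := (CharTwo.sub_eq_add _ _).symm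
  rw [h2, Polynomial.coe_sub]
  simp

theorem inv_mul (e k : ℕ) : ((1 + X : (ZMod 2)[X]) : PowerSeries (ZMod 2)) ^ k *
    (PowerSeries.invOneSubPow (ZMod 2) (e + k)).val = (PowerSeries.invOneSubPow (ZMod 2) e).val := by
  rw [one_add_X_eq, PowerSeries.invOneSubPow_add, Units.val_mul,
    mul_comm (PowerSeries.invOneSubPow (ZMod 2) e).val, ← mul_assoc,
    ← PowerSeries.invOneSubPow_inv_eq_one_sub_pow]
  simp

theorem res_u (a i : ℕ) : res a ((X ^ 2 + X) ^ i) = if i = a then 1 else 0 := by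
  have h : ((X : (ZMod 2)[X]) ^ 2 + X) ^ i = X ^ i * (1 + X) ^ i := by rw [← mul_pow]; ring
  rw [h, res]
  simp only [Polynomial.coe_mul, Polynomial.coe_pow, Polynomial.coe_X]
  rw [mul_assoc, PowerSeries.coeff_X_pow_mul']
  split_ifs with h1 h2 h2
  · subst h2
    have := inv_mul 1 i
    rw [Nat.add_comm] at this
    rw [this, PowerSeries.invOneSubPow_val_succ_eq_mk_add_choose]
    simp
  · obtain ⟨d, rfl⟩ := Nat.exists_eq_add_of_le h1
    have := inv_mul (d + 1) i
    rw [show i + d + 1 = d + 1 + i by ring, this,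
      PowerSeries.invOneSubPow_val_succ_eq_mk_add_choose]
    simp only [add_tsub_cancel_left, PowerSeries.coeff_mk]
    have h3 : 2 ∣ (d + d).choose d := by
      have := Nat.two_dvd_centralBinom_of_one_le (n := d) (by omega)
      rwa [Nat.centralBinom, two_mul] at this
    exact (ZMod.natCast_eq_zero_iff _ _).2 h3
  · omega
  · rfl

theorem res_v (a i j : ℕ) (h : a < 2 * (i + j - a)) (ha : a ≤ i + j) :
    res a ((1 + X) ^ i * (X ^ 2) ^ j) =
      if j ∈ range (a / 2 + 1) then (Nat.choose (i - a - 1) (a - 2 * j) : ZMod 2) else 0 := by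
  rw [mul_comm, ← pow_mul, res]
  simp only [Polynomial.coe_mul, Polynomial.coe_pow, Polynomial.coe_X]
  rw [mul_assoc, PowerSeries.coeff_X_pow_mul']
  have e : (2 * j ≤ a) ↔ j ∈ range (a / 2 + 1) := by rw [mem_range]; omega
  simp only [e]
  split_ifs with h1
  · rw [← e] at h1
    obtain ⟨d, rfl⟩ := Nat.exists_eq_add_of_le (show a + 1 ≤ i by omega)
    have := inv_mul 0 (a + 1)
    rw [pow_add, mul_comm _ (_ ^ d), mul_assoc]
    rw [zero_add] at this
    rw [this]
    simp only [PowerSeries.invOneSubPow_zero, Units.val_one, mul_one]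
    have h4 : ((1 + X : (ZMod 2)[X]) : PowerSeries (ZMod 2)) ^ d
      = (((1 + X : (ZMod 2)[X]) ^ d : (ZMod 2)[X]) : PowerSeries (ZMod 2)) := by simp
    rw [h4, Polynomial.coeff_coe, Polynomial.coeff_one_add_X_pow]
    congr 2
    omega
  · rfl

theorem X_pow_dvd_of_res (p : (ZMod 2)[X]) (m : ℕ) (h : ∀ a < m, res a p = 0) : X ^ m ∣ p := by
  rw [X_pow_dvd_iff]
  intro a
  induction a using Nat.strong_induction_on with
  | _ a ih =>
    intro ha
    have h0 := h a ha
    rw [res, PowerSeries.coeff_mul, Finset.sum_eq_single (a, 0)] at h0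
    · simpa [PowerSeries.invOneSubPow_val_succ_eq_mk_add_choose] using h0
    · rintro ⟨b, c⟩ hb hne
      have : b + c = a := by simpa using hb
      have hb' : b < a := by
        rcases Nat.eq_zero_or_pos c with rfl | hc
        · exact absurd (by simp at this; simp [this]) hne
        · omega
      simp [ih b hb' (by omega)]
    · intro hh; simp at hh

/-- Scalar form of the Adem relations in degree `n`. -/
def AdemC (n : ℕ) (c : ℕ → ZMod 2) : Prop :=
  ∀ a b, a + b = n → a < 2 * b →
    c a = ∑ k ∈ range (a / 2 + 1), (Nat.choose (b - k - 1) (a - 2 * k) : ZMod 2) * c (n - k)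

theorem res_bm_u (n : ℕ) (c : ℕ → ZMod 2) (a : ℕ) (ha : a ≤ n) :
    res a (bm n c (X ^ 2 + X) 1) = c a := by
  rw [bm, res_sum, Finset.sum_eq_single (a, n - a)]
  · simp [res_C_mul, res_u]
  · rintro ⟨i, j⟩ hb hne
    have h1 : i + j = n := by simpa using hb
    have : i ≠ a := by
      rintro rfl
      apply hne
      simp only [Prod.mk.injEq, true_and]; omega
    simp [res_C_mul, res_u, this]
  · intro h; simp at h; omega

theorem res_bm_v (n : ℕ) (c : ℕ → ZMod 2) (a b : ℕ) (hn : a + b = n) (hab : a < 2 * b) :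
    res a (bm n c (1 + X) (X ^ 2)) =
      ∑ k ∈ range (a / 2 + 1), (Nat.choose (b - k - 1) (a - 2 * k) : ZMod 2) * c (n - k) := by
  rw [bm, res_sum, ← Finset.Nat.sum_antidiagonal_swap,
    Finset.Nat.sum_antidiagonal_eq_sum_range_succ_mk]
  rw [← Finset.sum_subset (s₁ := range (a / 2 + 1))]
  · refine Finset.sum_congr rfl fun k hk => ?_
    have : k ≤ a / 2 := by rw [mem_range] at hk; omega
    simp only [Prod.swap, res_C_mul]
    rw [res_v a (n - k) k (by omega) (by omega), if_pos hk, mul_comm]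
    congr 3
    omega
  · intro x; simp only [mem_range]; omega
  · intro k hk hk'
    have : k ≤ n := by rw [mem_range] at hk; omega
    simp only [Prod.swap, res_C_mul]
    rw [res_v a (n - k) k (by omega) (by omega), if_neg hk', mul_zero]

theorem ademC_of_bm (n : ℕ) (c : ℕ → ZMod 2)
    (h : bm n c (X ^ 2 + X) 1 = bm n c (1 + X) (X ^ 2)) : AdemC n c := by
  intro a b hn hab
  rw [← res_bm_u n c a (by omega), h, res_bm_v n c a b hn hab]

theorem natDegree_bm (n : ℕ) (c : ℕ → ZMod 2) (u v : (ZMod 2)[X]) (hu : u.natDegree ≤ 2)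
    (hv : v.natDegree ≤ 2) : (bm n c u v).natDegree ≤ 2 * n := by
  refine natDegree_sum_le_of_forall_le _ _ ?_
  rintro ⟨i, j⟩ h
  have h1 : i + j = n := by simpa using h
  refine (natDegree_C_mul_le _ _).trans (natDegree_mul_le.trans ?_)
  have := natDegree_pow_le_of_le i hu
  have := natDegree_pow_le_of_le j hv
  dsimp only at *
  omega

theorem reflect_pow (u : (ZMod 2)[X]) (hu : u.natDegree ≤ 2) (i : ℕ) :
    reflect (2 * i) (u ^ i) = (reflect 2 u) ^ i := by
  induction i with
  | zero => simp
  | succ i ih =>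
    rw [pow_succ, pow_succ, Nat.mul_succ, reflect_mul _ _ _ hu, ih]
    exact (natDegree_pow_le_of_le i hu).trans (by omega)

theorem reflect_bm (n : ℕ) (c : ℕ → ZMod 2) (u v : (ZMod 2)[X]) (hu : u.natDegree ≤ 2)
    (hv : v.natDegree ≤ 2) :
    reflect (2 * n) (bm n c u v) = bm n c (reflect 2 u) (reflect 2 v) := by
  have : ∀ q, reflect (2 * n) q =
    (AddMonoidHom.mk' (reflect (2 * n)) (fun f g => reflect_add f g _)) q :=
      fun q : (ZMod 2)[X] => rfl
  rw [this, bm, map_sum]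
  refine Finset.sum_congr rfl ?_
  rintro ⟨i, j⟩ h
  have h1 : i + j = n := by simpa using h
  rw [← this, reflect_C_mul, ← h1, mul_add, reflect_mul, reflect_pow _ hu, reflect_pow _ hv]
  · exact (natDegree_pow_le_of_le i hu).trans (by omega)
  · exact (natDegree_pow_le_of_le j hv).trans (by omega)

theorem comp_bm (n : ℕ) (c : ℕ → ZMod 2) (u v w : (ZMod 2)[X]) :
    (bm n c u v).comp w = bm n c (u.comp w) (v.comp w) := by
  simp [bm, Polynomial.sum_comp]

theorem reflect_two_one : reflect 2 (1 : (ZMod 2)[X]) = X ^ 2 := by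
  simp

theorem reflect_two_X : reflect 2 (X : (ZMod 2)[X]) = X := by
  have := reflect_monomial (R := ZMod 2) 2 1
  rw [pow_one] at this
  rw [this, revAt_le (by norm_num)]
  norm_num

theorem reflect_two_X_sq : reflect 2 (X ^ 2 : (ZMod 2)[X]) = 1 := by
  rw [reflect_monomial, revAt_le le_rfl]; norm_num

theorem one_add_X_pow_dvd_reflect (N m : ℕ) (p : (ZMod 2)[X]) (hp : p.natDegree ≤ N)
    (h : (1 + X) ^ m ∣ p) : (1 + X) ^ m ∣ reflect N p := by
  obtain ⟨q, rfl⟩ := h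
  rcases eq_or_ne q 0 with rfl | hq
  · simp
  have hX : ((1 + X : (ZMod 2)[X])).Monic := by rw [add_comm]; exact monic_X_add_C 1
  have hd : ((1 + X : (ZMod 2)[X]) ^ m).natDegree = m := by
    rw [hX.natDegree_pow, add_comm, ← C_1, natDegree_X_add_C, mul_one]
  rw [(hX.pow m).natDegree_mul' hq, hd] at hp
  have key : reflect m ((1 + X : (ZMod 2)[X]) ^ m) = (1 + X) ^ m := by
    clear hp hd
    induction m with
    | zero => simp
    | succ m ih =>
      rw [pow_succ, reflect_mul (F := m) (G := 1), ih, reflect_add, ← C_1, reflect_C]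
      · have := reflect_monomial (R := ZMod 2) 1 1
        rw [pow_one] at this
        rw [this, revAt_le le_rfl]
        simp [add_comm]
      · refine (natDegree_pow_le_of_le m (m := 1) ?_).trans (by simp)
        rw [add_comm, ← C_1, natDegree_X_add_C]
      · rw [add_comm, ← C_1, natDegree_X_add_C]
  rw [show N = m + (N - m) by omega, reflect_mul _ _ hd.le (by omega), key]
  exact dvd_mul_right _ _

theorem X_pow_dvd_reflect_of (N m : ℕ) (p : (ZMod 2)[X]) (hp : p.natDegree + m ≤ N) :
    X ^ m ∣ reflect N p := by
  rw [X_pow_dvd_iff]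
  intro a ha
  rw [coeff_reflect, revAt_le (by omega)]
  exact coeff_eq_zero_of_natDegree_lt (by omega)

theorem natDegree_reflect_of_dvd (N m : ℕ) (p : (ZMod 2)[X]) (hp : p.natDegree ≤ N)
    (h : X ^ m ∣ p) : (reflect N p).natDegree + m ≤ N ∨ p = 0 := by
  rcases eq_or_ne p 0 with h0 | h0
  · exact Or.inr h0
  left
  have hm : m ≤ N := by
    have := natDegree_le_of_dvd h h0
    rw [natDegree_X_pow] at this
    omega
  have : (reflect N p).natDegree ≤ N - m := by
    rw [natDegree_le_iff_coeff_eq_zero]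
    intro a ha
    rw [coeff_reflect]
    rcases le_or_gt a N with h1 | h1
    · rw [revAt_le h1]
      exact X_pow_dvd_iff.1 h _ (by omega)
    · rw [revAt_eq_self_of_lt h1]
      exact coeff_eq_zero_of_natDegree_lt (by omega)
  omega

theorem bm_of_ademC (n : ℕ) (c : ℕ → ZMod 2) (h : AdemC n c) :
    bm n c (X ^ 2 + X) 1 = bm n c (1 + X) (X ^ 2) := by
  have d1 : (X ^ 2 + X : (ZMod 2)[X]).natDegree ≤ 2 := by compute_degree!
  have d2 : (1 + X : (ZMod 2)[X]).natDegree ≤ 2 := by compute_degree!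
  have d3 : (1 + X ^ 2 : (ZMod 2)[X]).natDegree ≤ 2 := by compute_degree!
  set h1 := bm n c (X ^ 2 + X) 1 with e1
  set h2 := bm n c (1 + X) (X ^ 2) with e2
  set h3 := bm n c X (1 + X ^ 2) with e3
  have two : ∀ p : (ZMod 2)[X], p + p = 0 := fun p => CharTwo.add_self_eq_zero p
  have D1 : h1.natDegree ≤ 2 * n := natDegree_bm _ _ _ _ d1 (by simp)
  have D2 : h2.natDegree ≤ 2 * n := natDegree_bm _ _ _ _ d2 (by simp)
  have D3 : h3.natDegree ≤ 2 * n := natDegree_bm _ _ _ _ (by simp) d3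
  have r1 : reflect (2 * n) h1 = h2 := by
    rw [e1, reflect_bm _ _ _ _ d1 (by simp), reflect_add, reflect_two_X, reflect_two_X_sq,
      reflect_two_one]
  have r2 : reflect (2 * n) h2 = h1 := by
    rw [e2, reflect_bm _ _ _ _ d2 (by simp), reflect_add, reflect_two_X, reflect_two_X_sq,
      reflect_two_one]
  have r3 : reflect (2 * n) h3 = h3 := by
    rw [e3, reflect_bm _ _ _ _ (by simp) d3, reflect_add, reflect_two_X, reflect_two_X_sq,
      reflect_two_one, add_comm]
  have s0 : (X ^ 2 : (ZMod 2)[X]).comp (1 + X) = 1 + X ^ 2 := by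
    rw [pow_comp, X_comp, add_pow_two]
    linear_combination two X
  have s1 : h1.comp (1 + X) = h1 := by
    rw [e1, comp_bm, add_comp, s0, one_comp, X_comp]
    congr 1
    linear_combination two 1
  have s2 : h2.comp (1 + X) = h3 := by
    rw [e2, comp_bm, add_comp, s0, one_comp, X_comp]
    congr 1
    linear_combination two 1
  have s3 : h3.comp (1 + X) = h2 := by
    rw [e3, comp_bm, add_comp, s0, one_comp, X_comp]
    congr 1
    linear_combination two 1
  obtain ⟨m, hm⟩ : ∃ m, m = (2 * n + 2) / 3 := ⟨_, rfl⟩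
  have v1 : X ^ m ∣ h1 + h2 := by
    apply X_pow_dvd_of_res
    intro a ha
    rw [res_add, e1, e2, res_bm_u n c a (by omega),
      res_bm_v n c a (n - a) (by omega) (by omega), ← h a (n - a) (by omega) (by omega)]
    exact CharTwo.add_self_eq_zero _
  have refl12 : reflect (2 * n) (h1 + h2) = h1 + h2 := by
    rw [reflect_add, r1, r2, add_comm]
  have refl13 : reflect (2 * n) (h1 + h3) = h2 + h3 := by
    rw [reflect_add, r1, r3]
  have refl23 : reflect (2 * n) (h2 + h3) = h1 + h3 := by
    rw [reflect_add, r2, r3]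
  have c12 : (h1 + h2).comp (1 + X) = h1 + h3 := by rw [add_comp, s1, s2]
  suffices hz : h1 + h2 = 0 by
    linear_combination hz - two h2
  by_contra hne
  have D12 : (h1 + h2).natDegree + m ≤ 2 * n := by
    have := natDegree_reflect_of_dvd (2 * n) m (h1 + h2)
      (natDegree_add_le_of_degree_le D1 D2) v1
    rw [refl12] at this
    exact this.resolve_right hne
  have v2 : (1 + X) ^ m ∣ h1 + h3 := by
    obtain ⟨q, hq⟩ := v1
    refine ⟨q.comp (1 + X), ?_⟩
    rw [← c12, hq, mul_comp, pow_comp, X_comp]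
  have v3 : (1 + X) ^ m ∣ h2 + h3 := by
    rw [← refl13]
    exact one_add_X_pow_dvd_reflect _ _ _ (natDegree_add_le_of_degree_le D1 D3) v2
  have v4 : (1 + X) ^ m ∣ h1 + h2 := by
    have := dvd_add v2 v3
    have e : h1 + h3 + (h2 + h3) = h1 + h2 := by linear_combination two h3
    rwa [e] at this
  have cop : IsCoprime ((X : (ZMod 2)[X]) ^ m) ((1 + X) ^ m) := by
    apply IsCoprime.pow
    exact ⟨-1, 1, by ring⟩
  obtain ⟨q, hq⟩ := cop.mul_dvd v1 v4
  have hX : ((1 + X : (ZMod 2)[X])).Monic := by rw [add_comm]; exact monic_X_add_C 1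
  have hmon : ((X : (ZMod 2)[X]) ^ m * (1 + X) ^ m).Monic := (monic_X_pow m).mul (hX.pow m)
  have hdeg : ((X : (ZMod 2)[X]) ^ m * (1 + X) ^ m).natDegree = 2 * m := by
    rw [(monic_X_pow m).natDegree_mul (hX.pow m), hX.natDegree_pow, natDegree_X_pow, add_comm 1 X,
      ← C_1, natDegree_X_add_C]
    ring
  have q0 : q ≠ 0 := by rintro rfl; rw [mul_zero] at hq; exact hne hq
  have hd : (h1 + h2).natDegree = 2 * m + q.natDegree := by
    rw [hq, hmon.natDegree_mul' q0, hdeg]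
  have hq1 : q.natDegree = 0 := by omega
  obtain ⟨k, rfl⟩ : ∃ k, q = C k := ⟨_, eq_C_of_natDegree_eq_zero hq1⟩
  have inv : (h1 + h2).comp (1 + X) = h1 + h2 := by
    rw [hq]
    simp only [mul_comp, pow_comp, X_comp, add_comp, one_comp, C_comp]
    have : (1 + (1 + X) : (ZMod 2)[X]) = X := by linear_combination two 1
    rw [this, mul_comm (X ^ m)]
  have z23 : h2 + h3 = 0 := by
    rw [c12] at inv
    linear_combination inv + two h2
  have z13 : h1 + h3 = 0 := by rw [← refl23, z23, reflect_zero]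
  apply hne
  rw [c12] at inv
  rw [← inv, z13]


section Families
variable {M : Type} [Ring M] [Algebra (ZMod 2) M]

/-- The family `x₀, x₁, …` satisfies the Adem relations. -/
def SatisfiesAdem {M : Type} [Semiring M] [Algebra (ZMod 2) M] (x : ℕ → M) : Prop :=
  ∀ i j, 0 < i → i < 2 * j → x i * x j =
    ∑ k ∈ range (i / 2 + 1), (Nat.choose (j - k - 1) (i - 2 * k) : ZMod 2) • (x (i + j - k) * x k)

/-- The coefficient of `X^e` in `∑_{i+j=n} u^i v^j x_i x_j`. -/
noncomputable def bmCoeff (x : ℕ → M) (u v : (ZMod 2)[X]) (n e : ℕ) : M :=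
  ∑ p ∈ antidiagonal n, (u ^ p.1 * v ^ p.2).coeff e • (x p.1 * x p.2)

theorem dual_bmCoeff (φ : Module.Dual (ZMod 2) M) (x : ℕ → M) (u v : (ZMod 2)[X]) (n e : ℕ) :
    φ (bmCoeff x u v n e) = (bm n (fun i => φ (x i * x (n - i))) u v).coeff e := by
  rw [bmCoeff, bm, map_sum, finsetSum_coeff]
  refine Finset.sum_congr rfl ?_
  rintro ⟨i, j⟩ h
  have h1 : i + j = n := by simpa using h
  have h2 : n - i = j := by omega
  simp only [map_smul, smul_eq_mul, coeff_C_mul, h2]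
  ring

theorem ext_dual {a b : M} (h : ∀ φ : Module.Dual (ZMod 2) M, φ a = φ b) : a = b := by
  rw [← sub_eq_zero, ← Module.forall_dual_apply_eq_zero_iff (ZMod 2)]
  intro φ
  rw [map_sub, h, sub_self]

theorem bmCoeff_eq_of_adem (x : ℕ → M) (h0 : x 0 = 1) (h : SatisfiesAdem x) (n e : ℕ) :
    bmCoeff x (X ^ 2 + X) 1 n e = bmCoeff x (1 + X) (X ^ 2) n e := by
  refine ext_dual fun φ => ?_
  rw [dual_bmCoeff, dual_bmCoeff, bm_of_ademC]
  intro a b hn hab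
  rcases Nat.eq_zero_or_pos a with rfl | ha
  · simp [h0]
  · have e1 : n - a = b := by omega
    simp only [e1]
    rw [h a b ha hab, map_sum]
    refine Finset.sum_congr rfl fun k hk => ?_
    have : k ≤ a / 2 := by rw [mem_range] at hk; omega
    rw [map_smul, smul_eq_mul, hn, show n - (n - k) = k by omega]

theorem adem_of_bmCoeff_eq (x : ℕ → M)
    (h : ∀ n e, bmCoeff x (X ^ 2 + X) 1 n e = bmCoeff x (1 + X) (X ^ 2) n e) :
    SatisfiesAdem x := by
  intro i j _ hij
  refine ext_dual fun φ => ?_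
  have key : AdemC (i + j) (fun a => φ (x a * x (i + j - a))) := by
    apply ademC_of_bm
    ext e
    rw [← dual_bmCoeff, ← dual_bmCoeff, h]
  have := key i j rfl hij
  simp only [Nat.add_sub_cancel_left] at this
  rw [this, map_sum]
  refine Finset.sum_congr rfl fun k hk => ?_
  have : k ≤ i / 2 := by rw [mem_range] at hk; omega
  rw [map_smul, smul_eq_mul, show i + j - (i + j - k) = k by omega]

/-- `Σ_n u^n x_n T^n`. -/
noncomputable def genSeries (x : ℕ → M) (u : (ZMod 2)[X]) : PowerSeries M[X] :=
  PowerSeries.mk fun n => (u ^ n).map (algebraMap (ZMod 2) M) * C (x n)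

theorem map_comm' (u : (ZMod 2)[X]) (p : M[X]) :
    Commute (u.map (algebraMap (ZMod 2) M)) p := by
  induction u using Polynomial.induction_on' with
  | add a b ha hb => rw [Polynomial.map_add]; exact ha.add_left hb
  | monomial n a =>
    rw [map_monomial, ← C_mul_X_pow_eq_monomial]
    refine Commute.mul_left ?_ (X_pow_mul (p := p) (n := n))
    ext k
    simp only [coeff_C_mul, coeff_mul_C, Algebra.commutes]

theorem C_mul_C_series (x y : ℕ → M) (u v : (ZMod 2)[X]) (i j : ℕ) :
    ((u ^ i).map (algebraMap (ZMod 2) M) * C (x i)) * ((v ^ j).map (algebraMap (ZMod 2) M) * C (y j))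
      = (u ^ i * v ^ j).map (algebraMap (ZMod 2) M) * C (x i * y j) := by
  rw [Polynomial.map_mul, C_mul, mul_assoc, ← mul_assoc (C (x i)), ← (map_comm' (v ^ j) (C (x i))).eq]
  simp only [mul_assoc]

theorem bm_iff (x : ℕ → M) (u v u' v' : (ZMod 2)[X]) :
    (∀ n e, bmCoeff x u v n e = bmCoeff x u' v' n e) ↔
      genSeries x u * genSeries x v = genSeries x u' * genSeries x v' := by
  have key : ∀ u v n e, (PowerSeries.coeff n (genSeries x u * genSeries x v)).coeff e =
      bmCoeff x u v n e := by
    intro u v n e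
    rw [PowerSeries.coeff_mul, bmCoeff, finsetSum_coeff]
    refine Finset.sum_congr rfl fun p _ => ?_
    simp only [genSeries, PowerSeries.coeff_mk]
    rw [C_mul_C_series, coeff_mul_C, coeff_map, Algebra.smul_def]
  constructor
  · intro h
    ext n e
    rw [key, key, h]
  · intro h n e
    rw [← key, ← key, h]

theorem genSeries_conv (x y : ℕ → M) (u : (ZMod 2)[X]) :
    genSeries (fun n => ∑ p ∈ antidiagonal n, x p.1 * y p.2) u = genSeries x u * genSeries y u := by
  ext1 n
  rw [PowerSeries.coeff_mul]
  simp only [genSeries, PowerSeries.coeff_mk]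
  rw [map_sum, Finset.mul_sum]
  refine Finset.sum_congr rfl ?_
  rintro ⟨i, j⟩ h
  have h1 : i + j = n := by simpa using h
  rw [C_mul_C_series, ← pow_add, h1]

theorem genSeries_comm (x y : ℕ → M) (h : ∀ i j, Commute (x i) (y j)) (u v : (ZMod 2)[X]) :
    genSeries x u * genSeries y v = genSeries y v * genSeries x u := by
  ext1 n
  rw [PowerSeries.coeff_mul, PowerSeries.coeff_mul, ← Finset.Nat.sum_antidiagonal_swap]
  refine Finset.sum_congr rfl ?_
  rintro ⟨i, j⟩ -
  simp only [genSeries, PowerSeries.coeff_mk, Prod.swap]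
  rw [C_mul_C_series, C_mul_C_series, (h j i).eq, mul_comm (u ^ j)]

/-- The Cauchy product of two commuting families satisfying the Adem relations satisfies them. -/
theorem SatisfiesAdem.conv (x y : ℕ → M) (hx0 : x 0 = 1) (hy0 : y 0 = 1)
    (hc : ∀ i j, Commute (x i) (y j)) (hx : SatisfiesAdem x) (hy : SatisfiesAdem y) :
    SatisfiesAdem (fun n => ∑ p ∈ antidiagonal n, x p.1 * y p.2) := by
  apply adem_of_bmCoeff_eq
  rw [bm_iff]
  have hx' := (bm_iff x _ _ _ _).1 (bmCoeff_eq_of_adem x hx0 hx)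
  have hy' := (bm_iff y _ _ _ _).1 (bmCoeff_eq_of_adem y hy0 hy)
  have key : ∀ u v, genSeries x u * genSeries y u * (genSeries x v * genSeries y v) =
      genSeries x u * genSeries x v * (genSeries y u * genSeries y v) := by
    intro u v
    rw [mul_assoc, ← mul_assoc (genSeries y u), ← genSeries_comm x y hc v u]
    simp only [mul_assoc]
  simp only [genSeries_conv, key, hx', hy']

end Families
end Auxiliary


open Finset TensorProduct Coalgebra WithConv

/-! ### The mod 2 Leibniz--Hopf algebra -/

/-- The mod 2 Leibniz--Hopf algebra `𝓕₂`: the free associative `𝔽₂`-algebra on generators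
`S¹, S², …` -/
abbrev LeibnizHopf : Type := FreeAlgebra (ZMod 2) ℕ+

/-- The element `Sⁿ` of `𝓕₂`, with the convention `S⁰ = 1`. -/
noncomputable def S (n : ℕ) : LeibnizHopf :=
  if h : 0 < n then FreeAlgebra.ι (ZMod 2) (n.toPNat h) else 1

@[simp] theorem S_zero : S 0 = 1 := rfl

theorem S_coe (n : ℕ+) : S n = FreeAlgebra.ι (ZMod 2) n := dif_pos n.pos

/-- The coproduct of `𝓕₂`: the algebra map with `Δ(Sⁿ) = ∑ Sⁱ ⊗ Sⁿ⁻ⁱ`. -/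
noncomputable def comulF : LeibnizHopf →ₐ[ZMod 2] LeibnizHopf ⊗[ZMod 2] LeibnizHopf :=
  FreeAlgebra.lift (ZMod 2) fun n : ℕ+ => ∑ p ∈ antidiagonal (n : ℕ), S p.1 ⊗ₜ[ZMod 2] S p.2

/-- The counit of `𝓕₂`: the algebra map killing all `Sⁿ`, `n > 0`. -/
noncomputable def counitF : LeibnizHopf →ₐ[ZMod 2] ZMod 2 :=
  FreeAlgebra.lift (ZMod 2) fun _ => 0

theorem comulF_S (n : ℕ) : comulF (S n) = ∑ p ∈ antidiagonal n, S p.1 ⊗ₜ[ZMod 2] S p.2 := by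
  rcases Nat.eq_zero_or_pos n with rfl | h
  · simp [Algebra.TensorProduct.one_def]
  · lift n to ℕ+ using h
    rw [S_coe, comulF, FreeAlgebra.lift_ι_apply]

theorem counitF_S (n : ℕ) : counitF (S n) = if n = 0 then 1 else 0 := by
  rcases Nat.eq_zero_or_pos n with rfl | h
  · simp
  · lift n to ℕ+ using h
    rw [S_coe, counitF, FreeAlgebra.lift_ι_apply, if_neg n.ne_zero]

theorem algHom_ext {B : Type} [Semiring B] [Algebra (ZMod 2) B]
    {f g : LeibnizHopf →ₐ[ZMod 2] B} (h : ∀ n, f (S n) = g (S n)) : f = g :=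
  FreeAlgebra.hom_ext (funext fun n => by
    have := h n
    rw [S_coe] at this
    exact this)

theorem sum_antidiagonal_assoc {B : Type} [AddCommMonoid B] (n : ℕ) (f : ℕ → ℕ → ℕ → B) :
    ∑ p ∈ antidiagonal n, ∑ q ∈ antidiagonal p.1, f q.1 q.2 p.2 =
      ∑ p ∈ antidiagonal n, ∑ q ∈ antidiagonal p.2, f p.1 q.1 q.2 := by
  rw [Finset.sum_sigma', Finset.sum_sigma']
  refine Finset.sum_nbij' (fun s => ⟨(s.2.1, s.2.2 + s.1.2), (s.2.2, s.1.2)⟩)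
    (fun s => ⟨(s.1.1 + s.2.1, s.2.2), (s.1.1, s.2.1)⟩) ?_ ?_ ?_ ?_ ?_
  · rintro ⟨⟨i, j⟩, ⟨k, l⟩⟩ h
    simp only [mem_sigma, HasAntidiagonal.mem_antidiagonal, and_true] at h ⊢
    omega
  · rintro ⟨⟨i, j⟩, ⟨k, l⟩⟩ h
    simp only [mem_sigma, HasAntidiagonal.mem_antidiagonal, and_true] at h ⊢
    omega
  · rintro ⟨⟨i, j⟩, ⟨k, l⟩⟩ h
    simp only [mem_sigma, HasAntidiagonal.mem_antidiagonal] at h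
    obtain ⟨h1, rfl⟩ := h
    rfl
  · rintro ⟨⟨i, j⟩, ⟨k, l⟩⟩ h
    simp only [mem_sigma, HasAntidiagonal.mem_antidiagonal] at h
    obtain ⟨h1, rfl⟩ := h
    rfl
  · intros; rfl

noncomputable instance : Bialgebra (ZMod 2) LeibnizHopf :=
  Bialgebra.ofAlgHom comulF counitF
    (by
      refine algHom_ext fun n => ?_
      simp only [AlgHom.comp_apply, comulF_S, map_sum, Algebra.TensorProduct.map_tmul,
        AlgHom.id_apply, TensorProduct.sum_tmul, TensorProduct.tmul_sum]
      refine Eq.trans ?_ (sum_antidiagonal_assoc n fun i j k => S i ⊗ₜ (S j ⊗ₜ S k))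
      rfl)
    (by
      refine algHom_ext fun n => ?_
      simp only [AlgHom.comp_apply, comulF_S, map_sum, Algebra.TensorProduct.map_tmul,
        AlgHom.id_apply, counitF_S]
      rw [Finset.sum_eq_single (0, n)]
      · simp
      · rintro ⟨i, j⟩ h hne
        have : i ≠ 0 := by
          rintro rfl
          simp at h hne
          exact hne h
        simp [this]
      · simp)
    (by
      refine algHom_ext fun n => ?_
      simp only [AlgHom.comp_apply, comulF_S, map_sum, Algebra.TensorProduct.map_tmul,
        AlgHom.id_apply, counitF_S]
      rw [Finset.sum_eq_single (n, 0)]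
      · simp
      · rintro ⟨i, j⟩ h hne
        have : j ≠ 0 := by
          rintro rfl
          simp at h hne
          exact hne h
        simp [this]
      · simp)

theorem comul_eq (x : LeibnizHopf) : comul (R := ZMod 2) x = comulF x := rfl
theorem counit_eq (x : LeibnizHopf) : counit (R := ZMod 2) x = counitF x := rfl

instance : IsCocomm (ZMod 2) LeibnizHopf where
  comm_comp_comul := by
    have : (Algebra.TensorProduct.comm (ZMod 2) LeibnizHopf LeibnizHopf).toAlgHom.comp comulF =
        comulF := by
      refine algHom_ext fun n => ?_
      simp only [AlgHom.comp_apply, comulF_S, map_sum]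
      rw [← Finset.Nat.sum_antidiagonal_swap]
      rfl
    exact congr(($this).toLinearMap)

/-! ### The mod 2 Steenrod algebra -/

/-- The Adem relations
`Sⁱ Sʲ = ∑_{k ≤ i/2} C(j-k-1, i-2k) S^{i+j-k} Sᵏ` for `0 < i < 2j`. -/
inductive AdemRel : LeibnizHopf → LeibnizHopf → Prop
  | adem (i j : ℕ) (hi : 0 < i) (hij : i < 2 * j) :
      AdemRel (S i * S j)
        (∑ k ∈ range (i / 2 + 1),
          (Nat.choose (j - k - 1) (i - 2 * k) : ZMod 2) • (S (i + j - k) * S k))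

/-- The mod 2 Steenrod algebra `𝓐₂`: the quotient of `𝓕₂` by the two-sided ideal generated by
the Adem relations. -/
abbrev SteenrodAlgebra : Type := RingQuot AdemRel

/-- The quotient map `π : 𝓕₂ → 𝓐₂`. -/
noncomputable def π : LeibnizHopf →ₐ[ZMod 2] SteenrodAlgebra := RingQuot.mkAlgHom (ZMod 2) AdemRel

theorem π_surjective : Function.Surjective π := RingQuot.mkAlgHom_surjective (ZMod 2) AdemRel

theorem satisfiesAdem_π : SatisfiesAdem fun n => π (S n) := by
  intro i j hi hij
  have := RingQuot.mkAlgHom_rel (ZMod 2) (AdemRel.adem i j hi hij)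
  simpa only [π, map_mul, map_sum, map_smul] using this

/-- An algebra map out of `𝓕₂` whose values on the `Sⁿ` satisfy the Adem relations factors through
`𝓐₂`. -/
noncomputable def liftA {B : Type} [Semiring B] [Algebra (ZMod 2) B] (f : LeibnizHopf →ₐ[ZMod 2] B)
    (h : SatisfiesAdem fun n => f (S n)) : SteenrodAlgebra →ₐ[ZMod 2] B :=
  RingQuot.liftAlgHom (ZMod 2) ⟨f, by
    rintro _ _ ⟨i, j, hi, hij⟩
    simpa only [map_mul, map_sum, map_smul] using h i j hi hij⟩

theorem liftA_comp {B : Type} [Semiring B] [Algebra (ZMod 2) B] (f : LeibnizHopf →ₐ[ZMod 2] B)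
    (h : SatisfiesAdem fun n => f (S n)) : (liftA f h).comp π = f := by
  ext1
  funext x
  simp [liftA, π]

theorem liftA_π {B : Type} [Semiring B] [Algebra (ZMod 2) B] (f : LeibnizHopf →ₐ[ZMod 2] B)
    (h : SatisfiesAdem fun n => f (S n)) (x : LeibnizHopf) : liftA f h (π x) = f x :=
  DFunLike.congr_fun (liftA_comp f h) x

theorem algHomA_ext {B : Type} [Semiring B] [Algebra (ZMod 2) B]
    {f g : SteenrodAlgebra →ₐ[ZMod 2] B} (h : ∀ n, f (π (S n)) = g (π (S n))) : f = g :=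
  RingQuot.ringQuot_ext' (ZMod 2) _ _ (algHom_ext h)

theorem map_comulF_S (n : ℕ) : Algebra.TensorProduct.map π π (comulF (S n)) =
    ∑ p ∈ antidiagonal n, π (S p.1) ⊗ₜ[ZMod 2] π (S p.2) := by
  simp only [comulF_S, map_sum, Algebra.TensorProduct.map_tmul]

/-- The Adem ideal is a coideal: the coproduct descends to `𝓐₂`. -/
theorem satisfiesAdem_comul : SatisfiesAdem fun n =>
    ((Algebra.TensorProduct.map π π).comp comulF) (S n) := by
  have hl : SatisfiesAdem fun n => π (S n) ⊗ₜ[ZMod 2] (1 : SteenrodAlgebra) := by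
    intro i j hi hij
    have := congrArg (Algebra.TensorProduct.includeLeft (R := ZMod 2) (S := ZMod 2)
      (A := SteenrodAlgebra) (B := SteenrodAlgebra)) (satisfiesAdem_π i j hi hij)
    simpa only [map_mul, map_sum, map_smul, Algebra.TensorProduct.includeLeft_apply] using this
  have hr : SatisfiesAdem fun n => (1 : SteenrodAlgebra) ⊗ₜ[ZMod 2] π (S n) := by
    intro i j hi hij
    have := congrArg (Algebra.TensorProduct.includeRight (R := ZMod 2)
      (A := SteenrodAlgebra) (B := SteenrodAlgebra)) (satisfiesAdem_π i j hi hij)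
    simpa only [map_mul, map_sum, map_smul, Algebra.TensorProduct.includeRight_apply] using this
  have h := SatisfiesAdem.conv (M := SteenrodAlgebra ⊗[ZMod 2] SteenrodAlgebra)
    (fun n => π (S n) ⊗ₜ[ZMod 2] 1) (fun n => 1 ⊗ₜ[ZMod 2] π (S n)) (by simp [Algebra.TensorProduct.one_def])
    (by simp [Algebra.TensorProduct.one_def])
    (fun i j => by
      rw [Commute, SemiconjBy, Algebra.TensorProduct.tmul_mul_tmul,
        Algebra.TensorProduct.tmul_mul_tmul]
      simp) hl hr
  simp only [Algebra.TensorProduct.tmul_mul_tmul, one_mul, mul_one] at h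
  have e : (fun n => ((Algebra.TensorProduct.map π π).comp comulF) (S n)) =
      fun n => ∑ p ∈ antidiagonal n, π (S p.1) ⊗ₜ[ZMod 2] π (S p.2) := funext map_comulF_S
  rw [e]
  exact h

/-- The coproduct of `𝓐₂`, induced by that of `𝓕₂`. -/
noncomputable def comulA : SteenrodAlgebra →ₐ[ZMod 2] SteenrodAlgebra ⊗[ZMod 2] SteenrodAlgebra :=
  liftA ((Algebra.TensorProduct.map π π).comp comulF) satisfiesAdem_comul

/-- The counit of `𝓐₂`, induced by that of `𝓕₂`. -/
noncomputable def counitA : SteenrodAlgebra →ₐ[ZMod 2] ZMod 2 :=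
  liftA counitF (by
    intro i j hi hij
    simp only [counitF_S]
    rw [if_neg hi.ne', zero_mul, eq_comm]
    refine Finset.sum_eq_zero fun k hk => ?_
    have : k ≤ i / 2 := by rw [mem_range] at hk; omega
    rw [if_neg (show i + j - k ≠ 0 by omega)]
    simp)

theorem comulA_π (x : LeibnizHopf) :
    comulA (π x) = Algebra.TensorProduct.map π π (comulF x) := by
  exact liftA_π _ satisfiesAdem_comul x

theorem counitA_π (x : LeibnizHopf) : counitA (π x) = counitF x := liftA_π _ _ x

theorem comulA_S (n : ℕ) :
    comulA (π (S n)) = ∑ p ∈ antidiagonal n, π (S p.1) ⊗ₜ[ZMod 2] π (S p.2) := by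
  rw [comulA_π, map_comulF_S]

noncomputable instance : Bialgebra (ZMod 2) SteenrodAlgebra :=
  Bialgebra.ofAlgHom comulA counitA
    (by
      refine algHomA_ext fun n => ?_
      simp only [AlgHom.comp_apply, comulA_S, map_sum, Algebra.TensorProduct.map_tmul,
        AlgHom.id_apply, TensorProduct.sum_tmul, TensorProduct.tmul_sum]
      refine Eq.trans ?_ (sum_antidiagonal_assoc n fun i j k => π (S i) ⊗ₜ (π (S j) ⊗ₜ π (S k)))
      rfl)
    (by
      refine algHomA_ext fun n => ?_
      simp only [AlgHom.comp_apply, comulA_S, map_sum, Algebra.TensorProduct.map_tmul,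
        AlgHom.id_apply, counitA_π, counitF_S]
      rw [Finset.sum_eq_single (0, n)]
      · simp
      · rintro ⟨i, j⟩ h hne
        have : i ≠ 0 := by
          rintro rfl
          simp at h hne
          exact hne h
        simp [this]
      · simp)
    (by
      refine algHomA_ext fun n => ?_
      simp only [AlgHom.comp_apply, comulA_S, map_sum, Algebra.TensorProduct.map_tmul,
        AlgHom.id_apply, counitA_π, counitF_S]
      rw [Finset.sum_eq_single (n, 0)]
      · simp
      · rintro ⟨i, j⟩ h hne
        have : j ≠ 0 := by
          rintro rfl
          simp at h hne
          exact hne h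
        simp [this]
      · simp)

instance : IsCocomm (ZMod 2) SteenrodAlgebra where
  comm_comp_comul := by
    have : (Algebra.TensorProduct.comm (ZMod 2) SteenrodAlgebra SteenrodAlgebra).toAlgHom.comp
        comulA = comulA := by
      refine algHomA_ext fun n => ?_
      simp only [AlgHom.comp_apply, comulA_S, map_sum]
      rw [← Finset.Nat.sum_antidiagonal_swap]
      rfl
    exact congr(($this).toLinearMap)

/-- `π` as a map of bialgebras. -/
noncomputable def πBialg : LeibnizHopf →ₐc[ZMod 2] SteenrodAlgebra :=
  BialgHom.ofAlgHom π
    (AlgHom.ext fun x => counitA_π x)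
    (AlgHom.ext fun x => (comulA_π x).symm)

/-! ### Monomials, gradings, graded duals -/

/-- `S^I = S^{i₁} ⋯ S^{iₙ}` in `𝓕₂`, for a finite sequence `I` of positive integers. -/
noncomputable def Smon (I : List ℕ+) : LeibnizHopf := (I.map fun i : ℕ+ => S i).prod

/-- `Sq^I = Sq^{i₁} ⋯ Sq^{iₙ}` in `𝓐₂`, where `Sqⁱ = π(Sⁱ)`. -/
noncomputable def Sqmon (I : List ℕ+) : SteenrodAlgebra := (I.map fun i : ℕ+ => π (S i)).prod

/-- The degree `i₁ + ⋯ + iₙ` of a sequence. -/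
def deg (I : List ℕ+) : ℕ := (I.map fun i : ℕ+ => (i : ℕ)).sum

/-- The degree `n` part of `𝓕₂`. -/
noncomputable def gradeF (n : ℕ) : Submodule (ZMod 2) LeibnizHopf :=
  Submodule.span (ZMod 2) (Smon '' {I | deg I = n})

/-- The degree `n` part of `𝓐₂`. -/
noncomputable def gradeA (n : ℕ) : Submodule (ZMod 2) SteenrodAlgebra :=
  Submodule.span (ZMod 2) (Sqmon '' {I | deg I = n})

section GradedDual
variable {H : Type} [Ring H] [Bialgebra (ZMod 2) H]

/-- The degree `n` part of `H ⊗ H`. -/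
def tensorGrade (𝒢 : ℕ → Submodule (ZMod 2) H) (n : ℕ) : Submodule (ZMod 2) (H ⊗[ZMod 2] H) :=
  Submodule.span (ZMod 2) {t | ∃ p q x y, p + q = n ∧ x ∈ 𝒢 p ∧ y ∈ 𝒢 q ∧ t = x ⊗ₜ y}

/-- The graded dual of `H`: the linear functionals on `H` that vanish in all sufficiently high
degrees, with the product dual to the coproduct of `H` (Mathlib's convolution product on
`WithConv (H →ₗ 𝔽₂)`, whose unit is the counit of `H`). -/
def gradedDual (𝒢 : ℕ → Submodule (ZMod 2) H)
    (h1 : ∀ n, 0 < n → ∀ x ∈ 𝒢 n, counit (R := ZMod 2) x = 0)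
    (h2 : ∀ n, ∀ x ∈ 𝒢 n, comul (R := ZMod 2) x ∈ tensorGrade 𝒢 n) :
    Subalgebra (ZMod 2) (WithConv (H →ₗ[ZMod 2] ZMod 2)) where
  carrier := {f | ∃ N, ∀ n, N < n → ∀ x ∈ 𝒢 n, f x = 0}
  add_mem' := by
    rintro f g ⟨N, hN⟩ ⟨K, hK⟩
    refine ⟨max N K, fun n hn x hx => ?_⟩
    have e : (f + g) x = f x + g x := rfl
    rw [e, hN n (by omega) x hx, hK n (by omega) x hx, add_zero]
  algebraMap_mem' := by
    intro r
    refine ⟨0, fun n hn x hx => ?_⟩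
    simp [h1 n hn x hx]
  mul_mem' := by
    rintro f g ⟨N, hN⟩ ⟨K, hK⟩
    refine ⟨N + K, fun n hn x hx => ?_⟩
    rw [LinearMap.convMul_apply]
    have h := h2 n x hx
    generalize comul (R := ZMod 2) x = z at h ⊢
    induction h using Submodule.span_induction with
    | mem t ht =>
      obtain ⟨p, q, y, z, hpq, hy, hz, rfl⟩ := ht
      rw [TensorProduct.map_tmul, LinearMap.mul'_apply]
      rcases le_or_gt p N with hp | hp
      · rw [hK q (by omega) z hz, mul_zero]
      · rw [hN p hp y hy, zero_mul]
    | zero => simp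
    | add a b _ _ ha hb => rw [map_add, map_add, ha, hb, add_zero]
    | smul r a _ ha => rw [map_smul, map_smul, ha, smul_zero]

end GradedDual

theorem Sqmon_eq (I : List ℕ+) : Sqmon I = π (Smon I) := by
  simp [Sqmon, Smon, map_list_prod, Function.comp_def]

theorem gradeA_eq (n : ℕ) : gradeA n = (gradeF n).map π.toLinearMap := by
  rw [gradeA, gradeF, Submodule.map_span, ← Set.image_comp]
  congr 2
  funext I
  exact Sqmon_eq I

theorem Smon_mem (I : List ℕ+) : Smon I ∈ gradeF (deg I) := Submodule.subset_span ⟨I, rfl, rfl⟩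

theorem S_mem (n : ℕ) : S n ∈ gradeF n := by
  rcases Nat.eq_zero_or_pos n with rfl | h
  · exact Smon_mem []
  · lift n to ℕ+ using h
    have := Smon_mem [n]
    simpa [Smon, deg] using this

theorem mul_mem_gradeF {p q : ℕ} {x y : LeibnizHopf} (hx : x ∈ gradeF p) (hy : y ∈ gradeF q) :
    x * y ∈ gradeF (p + q) := by
  induction hx, hy using Submodule.span_induction₂ with
  | mem_mem a b ha hb =>
    obtain ⟨I, hI, rfl⟩ := ha
    obtain ⟨J, hJ, rfl⟩ := hb
    refine Submodule.subset_span ⟨I ++ J, ?_, ?_⟩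
    · simp only [deg, Set.mem_ofPred_eq, List.map_append, List.sum_append] at *
      omega
    · simp [Smon]
  | zero_left => simp
  | zero_right => simp
  | add_left a b c _ _ _ h1 h2 => rw [add_mul]; exact add_mem h1 h2
  | add_right a b c _ _ _ h1 h2 => rw [mul_add]; exact add_mem h1 h2
  | smul_left r a b _ _ h => rw [smul_mul_assoc]; exact Submodule.smul_mem _ _ h
  | smul_right r a b _ _ h => rw [mul_smul_comm]; exact Submodule.smul_mem _ _ h

theorem mul_mem_tensorGrade {p q : ℕ} {x y : LeibnizHopf ⊗[ZMod 2] LeibnizHopf}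
    (hx : x ∈ tensorGrade gradeF p) (hy : y ∈ tensorGrade gradeF q) :
    x * y ∈ tensorGrade gradeF (p + q) := by
  induction hx, hy using Submodule.span_induction₂ with
  | mem_mem a b ha hb =>
    obtain ⟨p1, q1, x1, y1, h1, hx1, hy1, rfl⟩ := ha
    obtain ⟨p2, q2, x2, y2, h2, hx2, hy2, rfl⟩ := hb
    rw [Algebra.TensorProduct.tmul_mul_tmul]
    exact Submodule.subset_span ⟨p1 + p2, q1 + q2, _, _, by omega, mul_mem_gradeF hx1 hx2,
      mul_mem_gradeF hy1 hy2, rfl⟩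
  | zero_left => simp
  | zero_right => simp
  | add_left a b c _ _ _ h1 h2 => rw [add_mul]; exact add_mem h1 h2
  | add_right a b c _ _ _ h1 h2 => rw [mul_add]; exact add_mem h1 h2
  | smul_left r a b _ _ h => rw [smul_mul_assoc]; exact Submodule.smul_mem _ _ h
  | smul_right r a b _ _ h => rw [mul_smul_comm]; exact Submodule.smul_mem _ _ h

theorem comulF_Smon_mem (I : List ℕ+) : comulF (Smon I) ∈ tensorGrade gradeF (deg I) := by
  induction I with
  | nil =>
    refine Submodule.subset_span ⟨0, 0, 1, 1, rfl, Smon_mem [], Smon_mem [], ?_⟩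
    simp [Smon, Algebra.TensorProduct.one_def]
  | cons i I ih =>
    have e1 : Smon (i :: I) = S i * Smon I := by simp [Smon]
    have e2 : deg (i :: I) = i + deg I := by simp [deg]
    rw [e1, e2, map_mul, comulF_S]
    refine mul_mem_tensorGrade (sum_mem ?_) ih
    rintro ⟨p, q⟩ h
    exact Submodule.subset_span ⟨p, q, _, _, by simpa using h, S_mem p, S_mem q, rfl⟩

theorem counit_gradeF (n : ℕ) (hn : 0 < n) (x : LeibnizHopf) (hx : x ∈ gradeF n) :
    counit (R := ZMod 2) x = 0 := by
  induction hx using Submodule.span_induction with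
  | mem x hx =>
    obtain ⟨I, hI, rfl⟩ := hx
    rw [counit_eq]
    cases I with
    | nil => simp [deg] at hI; omega
    | cons i I =>
      have e1 : Smon (i :: I) = S i * Smon I := by simp [Smon]
      rw [e1, map_mul, counitF_S, if_neg i.pos.ne', zero_mul]
  | zero => simp
  | add a b _ _ ha hb => rw [map_add, ha, hb, add_zero]
  | smul r a _ ha => rw [map_smul, ha, smul_zero]

theorem comul_gradeF (n : ℕ) (x : LeibnizHopf) (hx : x ∈ gradeF n) :
    comul (R := ZMod 2) x ∈ tensorGrade gradeF n := by
  induction hx using Submodule.span_induction with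
  | mem x hx =>
    obtain ⟨I, hI, rfl⟩ := hx
    obtain rfl : deg I = n := hI
    exact comulF_Smon_mem I
  | zero => simp
  | add a b _ _ ha hb => rw [map_add]; exact add_mem ha hb
  | smul r a _ ha => rw [map_smul]; exact Submodule.smul_mem _ _ ha

theorem counit_gradeA (n : ℕ) (hn : 0 < n) (x : SteenrodAlgebra) (hx : x ∈ gradeA n) :
    counit (R := ZMod 2) x = 0 := by
  rw [gradeA_eq] at hx
  obtain ⟨y, hy, rfl⟩ := hx
  exact (counitA_π y).trans (counit_gradeF n hn y hy)

theorem comul_gradeA (n : ℕ) (x : SteenrodAlgebra) (hx : x ∈ gradeA n) :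
    comul (R := ZMod 2) x ∈ tensorGrade gradeA n := by
  rw [gradeA_eq] at hx
  obtain ⟨y, hy, rfl⟩ := hx
  have h := comul_gradeF n y hy
  have e : comul (R := ZMod 2) (π y) = Algebra.TensorProduct.map π π (comul (R := ZMod 2) y) :=
    comulA_π y
  rw [AlgHom.toLinearMap_apply, e]
  generalize comul (R := ZMod 2) y = z at h ⊢
  induction h using Submodule.span_induction with
  | mem t ht =>
    obtain ⟨p, q, a, b, hpq, ha, hb, rfl⟩ := ht
    rw [Algebra.TensorProduct.map_tmul]
    refine Submodule.subset_span ⟨p, q, _, _, hpq, ?_, ?_, rfl⟩ <;> rw [gradeA_eq]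
    · exact ⟨a, ha, rfl⟩
    · exact ⟨b, hb, rfl⟩
  | zero => simp
  | add a b _ _ ha hb => rw [map_add]; exact add_mem ha hb
  | smul r a _ ha => rw [map_smul]; exact Submodule.smul_mem _ _ ha

/-- The mod 2 dual Leibniz--Hopf algebra `𝓕₂*`. -/
noncomputable abbrev LeibnizHopfDual : Subalgebra (ZMod 2) (WithConv (LeibnizHopf →ₗ[ZMod 2] ZMod 2)) :=
  gradedDual gradeF counit_gradeF comul_gradeF

/-- The mod 2 dual Steenrod algebra `𝓐₂*`. -/
noncomputable abbrev SteenrodDual : Subalgebra (ZMod 2) (WithConv (SteenrodAlgebra →ₗ[ZMod 2] ZMod 2)) :=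
  gradedDual gradeA counit_gradeA comul_gradeA

/-- The algebra map `π* : 𝓐₂* → 𝓕₂*`, `f ↦ f ∘ π`, dual to `π`. -/
noncomputable def πDual : SteenrodDual →ₐ[ZMod 2] LeibnizHopfDual where
  toFun f := ⟨toConv (f.1.ofConv ∘ₗ π.toLinearMap), by
    obtain ⟨N, hN⟩ := f.2
    refine ⟨N, fun n hn x hx => hN n hn _ ?_⟩
    rw [gradeA_eq]
    exact ⟨x, hx, rfl⟩⟩
  map_one' := by
    ext x
    exact counitA_π x
  map_mul' f g := by
    have := LinearMap.convMul_comp_coalgHom_distrib f.1 g.1 (πBialg : LeibnizHopf →ₗc[ZMod 2] _)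
    exact Subtype.ext (WithConv.ext this)
  map_zero' := rfl
  map_add' _ _ := rfl
  commutes' r := by
    ext x
    exact congrArg (r * ·) (counitA_π x)

theorem basisFreeMonoid_eq (I : List ℕ+) :
    FreeAlgebra.basisFreeMonoid (ZMod 2) ℕ+ (FreeMonoid.ofList I) = Smon I := by
  have h : ∀ w : FreeMonoid ℕ+, FreeAlgebra.equivMonoidAlgebraFreeMonoid.symm
      (MonoidAlgebra.of (ZMod 2) (FreeMonoid ℕ+) w) = FreeMonoid.lift (FreeAlgebra.ι (ZMod 2)) w := by
    intro w
    simp [FreeAlgebra.equivMonoidAlgebraFreeMonoid]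
  refine (h _).trans ?_
  simp [Smon, FreeMonoid.lift_apply, S_coe]

/-- The basis element `S_I` of `𝓕₂*` dual to `S^I`: the functional reading off the coefficient of
the monomial `S^I`. -/
noncomputable def Sdual (I : List ℕ+) : LeibnizHopfDual :=
  ⟨toConv ((FreeAlgebra.basisFreeMonoid (ZMod 2) ℕ+).coord (FreeMonoid.ofList I)), by
    classical
    refine ⟨deg I, fun n hn x hx => ?_⟩
    induction hx using Submodule.span_induction with
    | mem x hx =>
      obtain ⟨J, hJ, rfl⟩ := hx
      obtain rfl : deg J = n := hJ
      rw [← basisFreeMonoid_eq]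
      refine (Module.Basis.coord_apply _ _ _).trans ?_
      rw [Module.Basis.repr_self, Finsupp.single_apply, if_neg]
      intro h
      rw [FreeMonoid.ofList.injective h] at hn
      exact hn.ne rfl
    | zero => exact map_zero _
    | add a b _ _ ha hb => exact (map_add _ a b).trans (by rw [ha, hb, add_zero])
    | smul r a _ ha => exact (map_smul _ r a).trans (by rw [ha, smul_zero])⟩

/-- The pairing `⟨S^J, S_I⟩ = δ_{IJ}`. -/
theorem Sdual_Smon (I J : List ℕ+) : (Sdual I).1 (Smon J) = if J = I then 1 else 0 := by
  classical
  rw [← basisFreeMonoid_eq]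
  refine (Module.Basis.coord_apply _ _ _).trans ?_
  rw [Module.Basis.repr_self, Finsupp.single_apply]
  simp only [FreeMonoid.ofList.injective.eq_iff]

/-! ### Admissible sequences -/

/-- A sequence `(j₁, …, jₙ)` of positive integers is admissible if `jₖ ≥ 2 jₖ₊₁` for all `k`. -/
def IsAdmissible (J : List ℕ+) : Prop := J.IsChain fun a b => 2 * b ≤ a

/-- The type of admissible sequences. -/
abbrev Admissible : Type := {J : List ℕ+ // IsAdmissible J}

/-- The sequence `(2ⁿ⁻¹, 2ⁿ⁻², …, 2⁰)` of length `n`. -/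
def milnorSeq : ℕ → List ℕ+
  | 0 => []
  | n + 1 => 2 ^ n :: milnorSeq n

theorem isAdmissible_milnorSeq : ∀ n, IsAdmissible (milnorSeq n)
  | 0 => List.IsChain.nil
  | 1 => List.IsChain.singleton _
  | n + 2 => List.IsChain.cons_cons (by rw [pow_succ, mul_comm]) (isAdmissible_milnorSeq (n + 1))

/-- The excess vector `γ(j₁, …, jₙ) = (j₁ - 2j₂, …, jₙ₋₁ - 2jₙ, jₙ)`. (On admissible sequences
no subtraction is truncated.) -/
def excess : List ℕ+ → List ℕ
  | [] => []
  | [j] => [(j : ℕ)]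
  | j :: k :: J => ((j : ℕ) - 2 * k) :: excess (k :: J)

/-- For `L = (l₁, …, lₙ)` and elements `x₁, x₂, …` (here indexed from `0`, so that `x k` stands for
`x_{k+1}`), the monomial `x₁^{l₁} ⋯ xₙ^{lₙ}`. -/
def monomialOf {R : Type} [CommRing R] (x : ℕ → R) (L : List ℕ) : R :=
  ∏ k : Fin L.length, x k ^ L.get k

/-- The right lexicographic order on sequences: `B < A` if `A` is longer than `B`, or if
they have the same length and at the last position where they differ the entry of `A` is bigger. -/
def RLexLT (B A : List ℕ+) : Prop :=
  B.length < A.length ∨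
    B.length = A.length ∧ ∃ k, ∃ (hB : k < B.length) (hA : k < A.length),
      B[k] < A[k] ∧ B.drop (k + 1) = A.drop (k + 1)

end Steenrod

namespace Steenrod

open Finset TensorProduct Coalgebra WithConv

/-! Everything rests on a triangular pairing. Pairing a product with `S^i y` obeys a Leibniz rule,
because Δ is multiplicative. For `ξ̄ₙ` only `i = 0` and `i = 2ⁿ⁻¹` contribute, the second lowering
the index to `n - 1`. On a word with n letters every letter must therefore be used: `ξ̄ₙ f` takes on
`S^I` the value of `f` on `S^{I - (2ⁿ⁻¹,…,2,1)}`, or 0 if the subtraction is impossible. Words may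
contain `S⁰ = 1`. Stripping off the factors of `ξ̄^L` one at a time, from the last variable down,
shows that it takes the value 1 on `S^I` for the sequence `I` with `γ(I) = L`, and that among words
of the same length it is otherwise nonzero only on right lexicographically larger ones
(`monomialOf_ξbar_triangular`). Padding with `S⁰` extends this to all lengths when `L = γ(J)` with
`J` admissible (`eq_or_rLexLT_of_monomialOf_ξbar_ne_zero`). Distinct exponent vectors have distinct
leading words, so the `ξ̄ₙ` are algebraically independent.

To descend to `𝓐₂`, one needs `ξ̄ₙ` to vanish on the Adem ideal. Let `𝓕₂` act on the span of the
`x^{2ᵏ}` in `𝔽₂[x]`, as Steenrod operations act on the cohomology of real projective space. The Adem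
relations hold there by the generating function identity of Bullett and Macdonald, and `S^I x` has a
nonzero coefficient at `x^{2ⁿ}` exactly for `I = (2ⁿ⁻¹,…,1)` (`milnorFunA_Sqmon`). So `ξ̄ₙ` is a
matrix coefficient of a representation of `𝓐₂`, that is, `π*` of an element `ξₙ`.

Admissible monomials span because the Adem relations lower the moment; they are independent because
they pair triangularly with the `ξ^{γ(J)}`. In the dual basis `ξ^{γ(J)}` is `Sq_J` plus larger terms
of degree at most that of `J`. There are finitely many of these, so descending induction shows that
the `ξₙ` generate. The statements on `π*` follow, since `π` is surjective and `π*(ξₙ) = ξ̄ₙ`. -/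

/-! ### The right lexicographic order on lists of natural numbers -/

/-- The strict right lexicographic order on lists of natural numbers of the same length. -/
def RLt : List ℕ → List ℕ → Prop
  | b :: B, a :: A => RLt B A ∨ B = A ∧ b < a
  | _, _ => False

theorem RLt.irrefl : ∀ A : List ℕ, ¬ RLt A A
  | [] => id
  | a :: A => by
    rintro (h | h)
    · exact RLt.irrefl A h
    · exact lt_irrefl _ h.2

theorem RLt.trans : ∀ {A B C : List ℕ}, RLt A B → RLt B C → RLt A C
  | a :: A, b :: B, c :: C => by
    rintro (h | ⟨rfl, h⟩) (h' | ⟨rfl, h'⟩)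
    · exact Or.inl (h.trans h')
    · exact Or.inl h
    · exact Or.inl h'
    · exact Or.inr ⟨rfl, h.trans h'⟩
  | [], _, _ => fun h => by simp [RLt] at h
  | _ :: _, [], _ => fun h => by simp [RLt] at h
  | _ :: _, _ :: _, [] => fun _ h => by simp [RLt] at h

theorem RLt.length_eq : ∀ {A B : List ℕ}, RLt A B → A.length = B.length
  | a :: A, b :: B => by
    rintro (h | ⟨rfl, h⟩)
    · simp [h.length_eq]
    · simp
  | [], _ => fun h => by simp [RLt] at h
  | _ :: _, [] => fun h => by simp [RLt] at h

/-- `RLt` recurses from the left end; this form exposes the last entry, which decides first and on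
which the induction over the last variable works. -/
theorem RLt.append_singleton_iff : ∀ {A B : List ℕ} {a b : ℕ}, A.length = B.length →
    (RLt (B ++ [b]) (A ++ [a]) ↔ b < a ∨ b = a ∧ RLt B A)
  | [], [], a, b, _ => by simp [RLt]
  | x :: A, y :: B, a, b, h => by
    have h' : A.length = B.length := by simpa using h
    have e : B ++ [b] = A ++ [a] ↔ B = A ∧ b = a := by
      rw [List.append_eq_append_iff_of_size_eq_right (by simp), List.singleton_inj]
    simp only [List.cons_append, RLt, RLt.append_singleton_iff h', e]
    tauto

theorem RLt.zipWith_add : ∀ {A B M : List ℕ}, A.length = M.length → RLt B A →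
    RLt (List.zipWith (· + ·) B M) (List.zipWith (· + ·) A M)
  | a :: A, b :: B, m :: M, hl, h => by
    have hl' : A.length = M.length := by simpa using hl
    rcases h with h | ⟨rfl, h⟩
    · exact Or.inl (RLt.zipWith_add hl' h)
    · exact Or.inr ⟨rfl, by simpa using h⟩
  | [], _ :: _, _, _, h => by simp [RLt] at h
  | _, [], _, _, h => by simp [RLt] at h
  | _ :: _, _ :: _, [], hl, _ => by simp at hl

/-- The right lexicographic order on sequences of positive integers, in terms of `RLt`. -/
theorem rLexLT_of_rLt : ∀ {A B : List ℕ+},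
    RLt (B.map (fun i : ℕ+ => (i : ℕ))) (A.map (fun i : ℕ+ => (i : ℕ))) → RLexLT B A
  | a :: A, b :: B => by
    intro h
    have hl : B.length = A.length := by simpa using h.length_eq
    refine Or.inr ⟨by simp [hl], ?_⟩
    rcases h with h | ⟨h1, h2⟩
    · rcases rLexLT_of_rLt h with h | ⟨_, k, hB, hA, h1, h2⟩
      · omega
      · exact ⟨k + 1, by simpa using hB, by simpa using hA, by simpa using h1, by simpa using h2⟩
    · have := (List.map_injective_iff.2 PNat.coe_injective) h1
      exact ⟨0, by simp, by simp, by simpa using h2, by simpa using this⟩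
  | [], _ :: _ => fun h => by simp [RLt] at h
  | [], [] => fun h => by simp [RLt] at h
  | _ :: _, [] => fun h => by simp [RLt] at h

theorem rLt_of_rLexLT : ∀ {A B : List ℕ+}, B.length = A.length → RLexLT B A →
    RLt (B.map (fun i : ℕ+ => (i : ℕ))) (A.map (fun i : ℕ+ => (i : ℕ)))
  | a :: A, b :: B => by
    rintro hl (h | ⟨-, k, hB, hA, h1, h2⟩)
    · omega
    have hl' : B.length = A.length := by simpa using hl
    cases k with
    | zero => exact Or.inr ⟨by simpa using congrArg _ h2, by simpa using h1⟩
    | succ k =>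
      exact Or.inl (rLt_of_rLexLT hl' (Or.inr ⟨hl', k, by simpa using hB, by simpa using hA,
        by simpa using h1, by simpa using h2⟩))
  | [], _ => by
    rintro hl (h | ⟨-, k, hB, hA, h1, h2⟩)
    · simp at h
    · simp at hA
  | _ :: _, [] => fun hl => by simp at hl

theorem RLexLT.irrefl (A : List ℕ+) : ¬ RLexLT A A :=
  fun h => RLt.irrefl _ (rLt_of_rLexLT rfl h)

theorem RLexLT.trans {A B C : List ℕ+} (h : RLexLT A B) (h' : RLexLT B C) : RLexLT A C := by
  have hAB : A.length ≤ B.length := h.elim le_of_lt fun h => h.1.le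
  have hBC : B.length ≤ C.length := h'.elim le_of_lt fun h => h.1.le
  rcases hAB.lt_or_eq with h1 | h1
  · exact Or.inl (h1.trans_le hBC)
  rcases hBC.lt_or_eq with h2 | h2
  · exact Or.inl (hAB.trans_lt h2)
  exact rLexLT_of_rLt ((rLt_of_rLexLT h1 h).trans (rLt_of_rLexLT h2 h'))

/-! ### The sequence with a given excess vector -/

/-- The sequence `(2ⁿ⁻¹, …, 2, 1)` as a list of natural numbers. -/
def milnorList : ℕ → List ℕ
  | 0 => []
  | n + 1 => 2 ^ n :: milnorList n

@[simp] theorem length_milnorList : ∀ n, (milnorList n).length = n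
  | 0 => rfl
  | n + 1 => by simp [milnorList, length_milnorList n]

theorem map_milnorSeq : ∀ n, (milnorSeq n).map (fun i : ℕ+ => (i : ℕ)) = milnorList n
  | 0 => rfl
  | n + 1 => by
    have : ((2 ^ n : ℕ+) : ℕ) = 2 ^ n := PNat.pow_coe 2 n
    simp [milnorSeq, milnorList, map_milnorSeq n, this]

/-- The sequence `J` of natural numbers with `γ(J) = L`. -/
def ofExcess : List ℕ → List ℕ
  | [] => []
  -- The default 0 stands for the absent next entry, so the last entry of the sequence is the last
  -- exponent itself.
  | l :: L => (l + 2 * (ofExcess L).headD 0) :: ofExcess L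

@[simp] theorem length_ofExcess : ∀ L, (ofExcess L).length = L.length
  | [] => rfl
  | l :: L => by simp [ofExcess, length_ofExcess L]

theorem ofExcess_injective : Function.Injective ofExcess
  | [], [] => fun _ => rfl
  | l :: L, m :: M => by
    intro h
    simp only [ofExcess, List.cons.injEq] at h
    obtain rfl := ofExcess_injective h.2
    simpa using h.1
  | [], _ :: _ => fun h => by simp [ofExcess] at h
  | _ :: _, [] => fun h => by simp [ofExcess] at h

/-- An unused last variable yields a trailing `S⁰ = 1`, so the number of variables can be lowered.
-/
theorem ofExcess_append_zero : ∀ L, ofExcess (L ++ [0]) = ofExcess L ++ [0]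
  | [] => rfl
  | [l] => rfl
  | l :: m :: L => by
    have := ofExcess_append_zero (m :: L)
    simp only [List.cons_append, ofExcess] at this ⊢
    simp_all

/-- Since `j_k = ∑_{m ≥ k} 2^{m-k} l_m`, raising the last exponent `l_n` by one adds `2^{n-k}` to
each `j_k`. Multiplication by `ξ̄ₙ` shifts words by the same vector. -/
theorem ofExcess_append_succ (l : ℕ) : ∀ L, ofExcess (L ++ [l + 1]) =
    List.zipWith (· + ·) (ofExcess (L ++ [l])) (milnorList (L.length + 1))
  | [] => by simp [ofExcess, milnorList]
  | m :: L => by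
    have ih := ofExcess_append_succ l L
    have hne : (ofExcess (L ++ [l])).length = L.length + 1 := by simp
    simp only [List.cons_append, ofExcess, ih, List.length_cons, milnorList, List.zipWith_cons_cons]
    congr 1
    match h : ofExcess (L ++ [l]) with
    | [] => simp [h] at hne
    | a :: A => simp [pow_succ]; ring

theorem length_excess : ∀ J : List ℕ+, (excess J).length = J.length
  | [] => rfl
  | [j] => rfl
  | j :: k :: J => by simp [excess, length_excess (k :: J)]

/-- Admissibility is what makes the subtractions `j_k - 2 j_{k+1}` exact and hence reversible. -/
theorem ofExcess_excess : ∀ {J : List ℕ+}, IsAdmissible J →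
    ofExcess (excess J) = J.map (fun i : ℕ+ => (i : ℕ))
  | [], _ => rfl
  | [j], _ => by simp [excess, ofExcess]
  | j :: k :: J, h => by
    have h' := ofExcess_excess (List.IsChain.of_cons h)
    have hjk : 2 * (k : ℕ) ≤ j := by
      have := (List.isChain_cons_cons.1 h).1
      exact_mod_cast this
    simp only [excess, ofExcess, h', List.map_cons, List.headD_cons, List.cons.injEq, and_true]
    omega

/-! ### Monomials with a given exponent vector -/

theorem monomialOf_eq_prod_range {R : Type} [CommRing R] (x : ℕ → R) (L : List ℕ) :
    monomialOf x L = ∏ k ∈ range L.length, x k ^ L.getD k 0 := by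
  rw [monomialOf, ← Fin.prod_univ_eq_prod_range (fun k => x k ^ L.getD k 0)]
  simp

theorem monomialOf_append {R : Type} [CommRing R] (x : ℕ → R) (L : List ℕ) (l : ℕ) :
    monomialOf x (L ++ [l]) = monomialOf x L * x L.length ^ l := by
  rw [monomialOf_eq_prod_range, monomialOf_eq_prod_range, List.length_append,
    List.length_singleton, prod_range_succ]
  congr 1
  · refine prod_congr rfl fun k hk => ?_
    rw [List.getD_append _ _ _ _ (mem_range.1 hk)]
  · simp

theorem monomialOf_nil {R : Type} [CommRing R] (x : ℕ → R) : monomialOf x [] = 1 := by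
  simp [monomialOf]

theorem map_monomialOf {R T : Type} [CommRing R] [CommRing T] (f : R →+* T) (x : ℕ → R)
    (L : List ℕ) : f (monomialOf x L) = monomialOf (fun k => f (x k)) L := by
  simp [monomialOf]

/-! ### Evaluating products in the dual Leibniz--Hopf algebra -/

/-- `S^{i₁} ⋯ S^{iₙ}` for a sequence of natural numbers, where `S⁰ = 1`. -/
noncomputable def SmonNat (I : List ℕ) : LeibnizHopf := (I.map S).prod

theorem SmonNat_cons (i : ℕ) (I : List ℕ) : SmonNat (i :: I) = S i * SmonNat I := by
  simp [SmonNat]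

theorem SmonNat_append (I J : List ℕ) : SmonNat (I ++ J) = SmonNat I * SmonNat J := by
  simp [SmonNat]

theorem SmonNat_map (I : List ℕ+) : SmonNat (I.map fun i : ℕ+ => (i : ℕ)) = Smon I := by
  simp [SmonNat, Smon, Function.comp_def]

theorem Smon_cons (i : ℕ+) (I : List ℕ+) : Smon (i :: I) = S i * Smon I := by
  simp [Smon]

theorem linearMap_ext_Smon {M : Type} [AddCommMonoid M] [Module (ZMod 2) M]
    {f g : LeibnizHopf →ₗ[ZMod 2] M} (h : ∀ I, f (Smon I) = g (Smon I)) : f = g :=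
  (FreeAlgebra.basisFreeMonoid (ZMod 2) ℕ+).ext fun I => by
    have := h (FreeMonoid.toList I)
    rwa [← basisFreeMonoid_eq, FreeMonoid.ofList_toList] at this

/-- The functional `y ↦ f (Sⁱ y)`. -/
noncomputable def translate (f : WithConv (LeibnizHopf →ₗ[ZMod 2] ZMod 2)) (i : ℕ) :
    WithConv (LeibnizHopf →ₗ[ZMod 2] ZMod 2) :=
  toConv (f.ofConv ∘ₗ LinearMap.mulLeft (ZMod 2) (S i))

theorem translate_apply (f : WithConv (LeibnizHopf →ₗ[ZMod 2] ZMod 2)) (i : ℕ) (y : LeibnizHopf) :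
    translate f i y = f (S i * y) := rfl

/-- The Leibniz rule: `Δ(Sⁱ y) = (∑ Sᵖ ⊗ S^q) Δ(y)`, and the product of functionals is dual to Δ. -/
theorem translate_mul (f g : WithConv (LeibnizHopf →ₗ[ZMod 2] ZMod 2)) (i : ℕ) :
    translate (f * g) i = ∑ p ∈ antidiagonal i, translate f p.1 * translate g p.2 := by
  ext y
  have hsum : (∑ p ∈ antidiagonal i, translate f p.1 * translate g p.2) y =
      ∑ p ∈ antidiagonal i, (translate f p.1 * translate g p.2) y := by
    induction antidiagonal i using Finset.induction_on with
    | empty => rfl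
    | insert a s ha ih => rw [sum_insert ha, sum_insert ha, ← ih]; rfl
  refine Eq.trans ?_ hsum.symm
  simp only [translate_apply, LinearMap.convMul_apply]
  rw [comul_eq, comul_eq, map_mul, comulF_S]
  -- Both sides are additive in `Δ(y)`, so pure tensors suffice.
  generalize comulF y = z
  induction z with
  | zero => simp
  | add a b ha hb => simp only [mul_add, map_add, ha, hb, sum_add_distrib]
  | tmul a b =>
    simp only [sum_mul, Algebra.TensorProduct.tmul_mul_tmul, map_sum, TensorProduct.map_tmul,
      LinearMap.mul'_apply]
    rfl

/-- The functional `S_{2ⁿ⁻¹, …, 2, 1}`. -/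
noncomputable def milnorFun (n : ℕ) : WithConv (LeibnizHopf →ₗ[ZMod 2] ZMod 2) :=
  (Sdual (milnorSeq n)).1

theorem milnorFun_Smon (n : ℕ) (I : List ℕ+) :
    milnorFun n (Smon I) = if I = milnorSeq n then 1 else 0 := Sdual_Smon _ _

theorem withConv_ext_Smon {f g : WithConv (LeibnizHopf →ₗ[ZMod 2] ZMod 2)}
    (h : ∀ I, f (Smon I) = g (Smon I)) : f = g :=
  WithConv.ext (linearMap_ext_Smon h)

theorem milnorFun_zero : milnorFun 0 = 1 := by
  refine withConv_ext_Smon fun I => ?_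
  rw [milnorFun_Smon]
  cases I with
  | nil => simp [milnorSeq, Smon]
  | cons i I => simp [milnorSeq, Smon_cons, counit_eq, counitF_S]

theorem translate_zero (f : WithConv (LeibnizHopf →ₗ[ZMod 2] ZMod 2)) : translate f 0 = f := by
  refine withConv_ext_Smon fun I => ?_
  simp [translate_apply]

theorem translate_milnorFun (n i : ℕ) : translate (milnorFun (n + 1)) i =
    if i = 0 then milnorFun (n + 1) else if i = 2 ^ n then milnorFun n else 0 := by
  rcases Nat.eq_zero_or_pos i with rfl | hi
  · simp [translate_zero]
  rw [if_neg hi.ne']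
  refine withConv_ext_Smon fun I => ?_
  lift i to ℕ+ using hi
  rw [translate_apply, ← Smon_cons, milnorFun_Smon]
  have h2 : ((2 ^ n : ℕ+) : ℕ) = 2 ^ n := PNat.pow_coe 2 n
  have h3 : i = 2 ^ n ↔ (i : ℕ) = 2 ^ n := by rw [← h2, PNat.coe_inj]
  simp only [milnorSeq, List.cons.injEq, h3]
  split_ifs with h4 h5 h5
  · rw [milnorFun_Smon, if_pos h4.2]
  · exact absurd h4.1 h5
  · rw [milnorFun_Smon, if_neg fun h => h4 ⟨h5, h⟩]
  · rfl

/-- Of the Leibniz sum only two terms survive: the first factor absorbs either nothing or exactly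
its leading letter `2ⁿ`. -/
theorem translate_milnorFun_mul (n i : ℕ) (f : WithConv (LeibnizHopf →ₗ[ZMod 2] ZMod 2)) :
    translate (milnorFun (n + 1) * f) i = milnorFun (n + 1) * translate f i +
      if 2 ^ n ≤ i then milnorFun n * translate f (i - 2 ^ n) else 0 := by
  have hn : 2 ^ n ≠ 0 := by positivity
  rw [translate_mul, Finset.Nat.sum_antidiagonal_eq_sum_range_succ_mk,
    sum_range_succ', add_comm]
  simp only [translate_milnorFun, Nat.sub_zero, if_true, Nat.succ_ne_zero, if_false]
  congr 1
  -- With the term for index 0 split off, the remaining sum is indexed one lower, so the surviving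
  -- term sits at `m = 2ⁿ - 1`.
  obtain ⟨m, hm⟩ := Nat.exists_eq_succ_of_ne_zero hn
  split_ifs with h
  · rw [Finset.sum_eq_single m]
    · simp [hm]
    · intro b _ hb
      rw [if_neg (by omega), zero_mul]
    · intro h'; rw [mem_range] at h'; omega
  · refine sum_eq_zero fun b hb => ?_
    rw [mem_range] at hb
    rw [if_neg (by omega), zero_mul]

theorem milnorFun_mul_apply_one (n : ℕ) (f : WithConv (LeibnizHopf →ₗ[ZMod 2] ZMod 2)) :
    (milnorFun (n + 1) * f) 1 = 0 := by
  rw [LinearMap.convMul_apply, Bialgebra.comul_one, Algebra.TensorProduct.one_def,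
    TensorProduct.map_tmul, LinearMap.mul'_apply]
  have : milnorFun (n + 1) 1 = 0 := by
    have := milnorFun_Smon (n + 1) []
    simpa [Smon, milnorSeq] using this
  exact mul_eq_zero_of_left this _

/-- Each letter lowers the index of the first factor by at most one. With fewer than `n` letters the
index is still positive when the word is exhausted, and such a functional kills 1. -/
theorem milnorFun_mul_of_length_lt (I : List ℕ) : ∀ (n : ℕ)
    (f : WithConv (LeibnizHopf →ₗ[ZMod 2] ZMod 2)), I.length < n →
    (milnorFun n * f) (SmonNat I) = 0 := by
  induction I with
  | nil =>
    intro n f hn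
    obtain ⟨n, rfl⟩ : ∃ m, n = m + 1 := ⟨n - 1, by simp at hn; omega⟩
    exact milnorFun_mul_apply_one n f
  | cons i I ih =>
    intro n f hn
    rw [List.length_cons] at hn
    obtain ⟨n, rfl⟩ : ∃ m, n = m + 1 := ⟨n - 1, by omega⟩
    rw [SmonNat_cons, ← translate_apply, translate_milnorFun_mul]
    split_ifs
    · exact (congrArg₂ (· + ·) (ih _ _ (by omega)) (ih _ _ (by omega))).trans (add_zero _)
    · rw [add_zero, ih _ _ (by omega)]

/-- With exactly `n + 1` letters none may be skipped: the branch that leaves the index unchanged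
dies for lack of letters. -/
theorem milnorFun_mul_cons (n i : ℕ) (I : List ℕ) (hI : I.length = n)
    (f : WithConv (LeibnizHopf →ₗ[ZMod 2] ZMod 2)) :
    (milnorFun (n + 1) * f) (SmonNat (i :: I)) =
      if 2 ^ n ≤ i then (milnorFun n * translate f (i - 2 ^ n)) (SmonNat I) else 0 := by
  rw [SmonNat_cons, ← translate_apply, translate_milnorFun_mul]
  have h := milnorFun_mul_of_length_lt I (n + 1) (translate f i) (by omega)
  split_ifs
  · exact (congrArg₂ (· + ·) h rfl).trans (zero_add _)
  · rw [add_zero, h]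

/-- The forced choices subtract `2ⁿ⁻¹, …, 2, 1` from the successive letters and leave the rest to
`f`. The next lemma is the complementary case: if some subtraction is impossible, the value is 0. -/
theorem milnorFun_mul_zipWith (I : List ℕ) : ∀ (f : WithConv (LeibnizHopf →ₗ[ZMod 2] ZMod 2)),
    (milnorFun I.length * f) (SmonNat (List.zipWith (· + ·) I (milnorList I.length))) =
      f (SmonNat I) := by
  induction I with
  | nil => intro f; simp [milnorFun_zero, milnorList]
  | cons i I ih =>
    intro f
    rw [List.length_cons, milnorList, List.zipWith_cons_cons, milnorFun_mul_cons _ _ _ (by simp),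
      if_pos (by omega), ih, Nat.add_sub_cancel, translate_apply, SmonNat_cons]

theorem exists_of_milnorFun_mul_ne_zero (I : List ℕ) :
    ∀ (f : WithConv (LeibnizHopf →ₗ[ZMod 2] ZMod 2)),
    (milnorFun I.length * f) (SmonNat I) ≠ 0 →
      ∃ K : List ℕ, K.length = I.length ∧ I = List.zipWith (· + ·) K (milnorList I.length) := by
  induction I with
  | nil => intro f _; exact ⟨[], rfl, rfl⟩
  | cons i I ih =>
    intro f h
    rw [List.length_cons, milnorFun_mul_cons _ _ _ rfl] at h
    split_ifs at h with hi
    · obtain ⟨K, hK, hI⟩ := ih _ h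
      refine ⟨(i - 2 ^ I.length) :: K, by simp [hK], ?_⟩
      rw [List.length_cons, milnorList, List.zipWith_cons_cons, ← hI, Nat.sub_add_cancel hi]
    · exact absurd rfl h

/-- The elements `ξ̄ₙ₊₁`. -/
noncomputable def ξbar (n : ℕ) : LeibnizHopfDual := Sdual (milnorSeq (n + 1))

/-- The pairing of monomials in the `ξ̄ₙ` with the `S^I` is triangular. -/
theorem monomialOf_ξbar_triangular (L : List ℕ) : ∀ I : List ℕ, I.length = L.length →
    (I = ofExcess L → (monomialOf ξbar L).1 (SmonNat I) = 1) ∧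
    ((monomialOf ξbar L).1 (SmonNat I) ≠ 0 → I = ofExcess L ∨ RLt (ofExcess L) I) := by
  induction L using List.reverseRecOn with
  | nil =>
    intro I hI
    obtain rfl : I = [] := by simpa using hI
    refine ⟨fun _ => ?_, fun _ => Or.inl rfl⟩
    rw [monomialOf_nil]
    simp [SmonNat]
  -- Inner induction on the last exponent: a positive one gives up a factor `ξ̄ₙ`, and at 0 the last
  -- variable is dropped.
  | append_singleton L l ihL =>
    induction l with
    | zero =>
      intro I hI
      obtain ⟨I, i, rfl⟩ : ∃ K i, I = K ++ [i] := by
        rcases List.eq_nil_or_concat I with rfl | ⟨K, i, h⟩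
        · simp at hI
        · exact ⟨K, i, by simpa using h⟩
      have hI' : I.length = L.length := by simpa using hI
      rw [monomialOf_append, pow_zero, mul_one, ofExcess_append_zero,
        RLt.append_singleton_iff (by simp [hI'])]
      rcases Nat.eq_zero_or_pos i with rfl | hi
      · have e : SmonNat (I ++ [0]) = SmonNat I := by simp [SmonNat]
        rw [e]
        simpa using ihL I hI'
      -- A positive last letter already beats the last entry 0 of the leading word, so nothing has
      -- to be evaluated.
      · refine ⟨fun h => ?_, fun _ => Or.inr (Or.inl hi)⟩
        have := List.append_inj_right' h rfl
        simp at this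
        omega
    | succ l ihl =>
      intro I hI
      have e : (monomialOf ξbar (L ++ [l + 1])).1 =
          milnorFun (L.length + 1) * (monomialOf ξbar (L ++ [l])).1 := by
        rw [monomialOf_append, pow_succ, ← mul_assoc, ← monomialOf_append, mul_comm]
        rfl
      have hI' : I.length = L.length + 1 := by simpa using hI
      rw [e, ofExcess_append_succ]
      constructor
      · rintro rfl
        have := milnorFun_mul_zipWith (ofExcess (L ++ [l])) (monomialOf ξbar (L ++ [l])).1
        simp only [length_ofExcess, List.length_append, List.length_singleton] at this
        rw [this]
        exact (ihl _ (by simp)).1 rfl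
      · intro h
        rw [← hI'] at h
        obtain ⟨K, hK, hKI⟩ := exists_of_milnorFun_mul_ne_zero I _ h
        rw [← hK] at hKI h
        rw [hKI, milnorFun_mul_zipWith] at h
        rw [hKI, ← hI', ← hK]
        rcases (ihl K (by simp [hK, hI'])).2 h with h1 | h1
        · left; rw [← h1]
        · right; exact RLt.zipWith_add (by simp) h1

/-! ### The action on the span of the powers `x^{2ᵏ}` -/

/-- The action of `Sqⁱ` on the span of the `eₖ = x^{2ᵏ}` in `𝔽₂[x]`: `Sq⁰` is the identity and
`Sq^{2ᵏ} eₖ = eₖ₊₁`. -/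
noncomputable def frobAction (i : ℕ) : Module.End (ZMod 2) (ℕ →₀ ZMod 2) :=
  if i = 0 then 1 else
    Finsupp.lift (ℕ →₀ ZMod 2) (ZMod 2) ℕ
      fun k => if i = 2 ^ k then Finsupp.single (k + 1) 1 else 0

theorem frobAction_zero : frobAction 0 = 1 := if_pos rfl

theorem frobAction_single (i k : ℕ) : frobAction i (Finsupp.single k 1) =
    if i = 0 then Finsupp.single k 1 else if i = 2 ^ k then Finsupp.single (k + 1) 1 else 0 := by
  rw [frobAction]
  split_ifs <;> simp_all

-- On `e_k` only the pairs `(0,0)`, `(2ᵏ,0)`, `(0,2ᵏ)` and `(2ᵏ⁺¹,2ᵏ)` act nontrivially, so the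
-- generating function depends on `u` and `v` only through `u + v` and `u²v`.
open Polynomial in
theorem bmCoeff_frobAction (u v : (ZMod 2)[X]) (n e k : ℕ) :
    bmCoeff frobAction u v n e (Finsupp.single k 1) =
      (if n = 0 then (1 : (ZMod 2)[X]).coeff e • Finsupp.single k 1 else 0) +
      (if n = 2 ^ k then ((u + v) ^ 2 ^ k).coeff e • Finsupp.single (k + 1) 1 else 0) +
      (if n = 3 * 2 ^ k then ((u ^ 2 * v) ^ 2 ^ k).coeff e • Finsupp.single (k + 2) 1 else 0) := by
  have hk : 2 ^ k ≠ 0 := by positivity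
  have h2 : 2 ^ (k + 1) = 2 * 2 ^ k := by ring
  have hk' : 2 ^ (k + 1) ≠ 0 := by positivity
  have summand : ∀ p : ℕ × ℕ, ((u ^ p.1 * v ^ p.2).coeff e • (frobAction p.1 * frobAction p.2))
      (Finsupp.single k 1) =
      (if p = (0, 0) then (1 : (ZMod 2)[X]).coeff e • Finsupp.single k 1 else 0) +
      (if p = (2 ^ k, 0) then (u ^ 2 ^ k).coeff e • Finsupp.single (k + 1) 1 else 0) +
      (if p = (0, 2 ^ k) then (v ^ 2 ^ k).coeff e • Finsupp.single (k + 1) 1 else 0) +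
      (if p = (2 ^ (k + 1), 2 ^ k) then
        ((u ^ 2 * v) ^ 2 ^ k).coeff e • Finsupp.single (k + 2) 1 else 0) := by
    rintro ⟨i, j⟩
    rw [LinearMap.smul_apply, Module.End.mul_apply, frobAction_single]
    simp only [Prod.mk.injEq]
    rcases eq_or_ne j 0 with rfl | hj
    · rw [if_pos rfl, frobAction_single]
      rcases eq_or_ne i 0 with rfl | hi
      · simp [hk.symm]
      · by_cases hik : i = 2 ^ k
        · subst hik; simp
        · simp [hi, hik, hk.symm]
    · rw [if_neg hj]
      by_cases hjk : j = 2 ^ k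
      · subst hjk
        rw [if_pos rfl, frobAction_single]
        rcases eq_or_ne i 0 with rfl | hi
        · simp [hk'.symm]
        · by_cases hik : i = 2 ^ (k + 1)
          · subst hik
            simp [mul_pow, ← pow_mul, h2]
          · simp [hi, hik]
      · simp [hj, hjk]
  rw [bmCoeff, LinearMap.sum_apply, sum_congr rfl fun p _ => summand p]
  simp only [sum_add_distrib, sum_ite_eq', HasAntidiagonal.mem_antidiagonal, add_zero, zero_add]
  have e1 : 0 = n ↔ n = 0 := eq_comm
  have e2 : 2 ^ k = n ↔ n = 2 ^ k := eq_comm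
  have e3 : 2 ^ (k + 1) + 2 ^ k = n ↔ n = 3 * 2 ^ k := by omega
  simp only [e1, e2, e3]
  -- In characteristic 2, `u^{2ᵏ} + v^{2ᵏ} = (u + v)^{2ᵏ}`; this merges the two middle terms.
  rw [add_pow_char_pow, coeff_add, add_smul, add_assoc (ite (n = 0) _ _)]
  congr 2
  split_ifs <;> simp

/-- The pairs `(X² + X, 1)` and `(1 + X, X²)` have the same `u + v` and the same `u²v`, which is all
that the generating function sees. -/
theorem satisfiesAdem_frobAction : SatisfiesAdem frobAction := by
  refine adem_of_bmCoeff_eq (M := Module.End (ZMod 2) (ℕ →₀ ZMod 2)) frobAction ?_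
  intro n e
  refine Finsupp.lhom_ext' fun k => LinearMap.ext_ring ?_
  simp only [LinearMap.comp_apply, Finsupp.lsingle_apply, bmCoeff_frobAction]
  have h1 : (Polynomial.X ^ 2 + Polynomial.X + 1 : Polynomial (ZMod 2)) =
      1 + Polynomial.X + Polynomial.X ^ 2 := by ring
  have h2 : ((Polynomial.X ^ 2 + Polynomial.X) ^ 2 * 1 : Polynomial (ZMod 2)) =
      (1 + Polynomial.X) ^ 2 * Polynomial.X ^ 2 := by ring
  rw [h1, h2]

/-- The action of `𝓕₂` on the span of the `x^{2ᵏ}`. -/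
noncomputable def actionF : LeibnizHopf →ₐ[ZMod 2] Module.End (ZMod 2) (ℕ →₀ ZMod 2) :=
  FreeAlgebra.lift (ZMod 2) fun n : ℕ+ => frobAction n

theorem actionF_S (n : ℕ) : actionF (S n) = frobAction n := by
  rcases Nat.eq_zero_or_pos n with rfl | h
  · rw [S_zero, map_one, frobAction_zero]
  · lift n to ℕ+ using h
    rw [S_coe, actionF, FreeAlgebra.lift_ι_apply]

/-- The action of `𝓐₂` on the span of the `x^{2ᵏ}`. -/
noncomputable def actionA : SteenrodAlgebra →ₐ[ZMod 2] Module.End (ZMod 2) (ℕ →₀ ZMod 2) :=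
  liftA actionF (by simp only [actionF_S]; exact satisfiesAdem_frobAction)

/-- Read from the right, the letters must climb `e₀ → e₁ → e₂ → ⋯`, and the only positive-degree
generator not killing `e_k` is `S^{2ᵏ}`. -/
theorem actionF_Smon (I : List ℕ+) : actionF (Smon I) (Finsupp.single 0 1) =
    if I = milnorSeq I.length then Finsupp.single I.length 1 else 0 := by
  induction I with
  | nil => simp [Smon, milnorSeq]
  | cons i I ih =>
    have h2 : ((2 ^ I.length : ℕ+) : ℕ) = 2 ^ I.length := PNat.pow_coe 2 _
    have h3 : i = 2 ^ I.length ↔ (i : ℕ) = 2 ^ I.length := by rw [← h2, PNat.coe_inj]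
    rw [Smon_cons, map_mul, Module.End.mul_apply, ih, actionF_S]
    simp only [List.length_cons, milnorSeq, List.cons.injEq, h3]
    split_ifs with h4 h5 h5
    · rw [frobAction_single, if_neg i.ne_zero, if_pos h5.1]
    · rw [frobAction_single, if_neg i.ne_zero, if_neg fun h => h5 ⟨h, h4⟩]
    · exact absurd h5.2 h4
    · rw [map_zero]

/-- The functional on `𝓐₂` reading off the coefficient of `x^{2ⁿ}` in `θ x`. -/
noncomputable def milnorFunA (n : ℕ) : SteenrodAlgebra →ₗ[ZMod 2] ZMod 2 :=
  Finsupp.lapply n ∘ₗ LinearMap.applyₗ (Finsupp.single 0 1) ∘ₗ actionA.toLinearMap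

/-- This shows that the functional `S_{2ⁿ⁻¹,…,1}` factors through `π`; in particular it vanishes on
the Adem ideal. -/
theorem milnorFunA_Sqmon (n : ℕ) (I : List ℕ+) :
    milnorFunA n (Sqmon I) = if I = milnorSeq n then 1 else 0 := by
  have h : ∀ n, (milnorSeq n).length = n := fun n => by
    rw [← List.length_map (fun i : ℕ+ => (i : ℕ)), map_milnorSeq, length_milnorList]
  have e : milnorFunA n (Sqmon I) = (actionF (Smon I) (Finsupp.single 0 1)) n := by
    rw [Sqmon_eq]
    exact congrArg (fun a : Module.End (ZMod 2) (ℕ →₀ ZMod 2) => a (Finsupp.single 0 1) n)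
      (liftA_π actionF _ (Smon I))
  rw [e, actionF_Smon]
  split_ifs with h1 h2 h2
  · rw [← h n, ← h2, Finsupp.single_eq_same]
  · rw [Finsupp.single_eq_of_ne]
    rintro rfl
    exact h2 h1
  · exact absurd (by rw [h2, h]) h1
  · rfl

/-! ### Admissible monomials span -/

/-- The moment `i₁ + 2 i₂ + 3 i₃ + ⋯` of a sequence. -/
def moment : List ℕ → ℕ
  | [] => 0
  | i :: I => i + I.sum + moment I

theorem moment_append : ∀ I J : List ℕ, moment (I ++ J) = moment I + I.length * J.sum + moment J
  | [], J => by simp [moment]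
  | i :: I, J => by
    simp only [List.cons_append, moment, moment_append I J, List.sum_append, List.length_cons]
    ring

theorem deg_eq_sum (I : List ℕ+) : deg I = (I.map fun i : ℕ+ => (i : ℕ)).sum := rfl

/-- The span of the admissible monomials of degree `n`. -/
noncomputable def admissibleSpan (n : ℕ) : Submodule (ZMod 2) SteenrodAlgebra :=
  Submodule.span (ZMod 2) (Sqmon '' {J | IsAdmissible J ∧ deg J = n})

/-- An Adem relation at a non-admissible spot keeps the length and lowers the moment. Removing a
letter `S⁰` lowers the length without raising the moment, so the sum of the two is a terminating
measure. -/
theorem π_SmonNat_mem_admissibleSpan (m : ℕ) : ∀ I : List ℕ, moment I + I.length < m →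
    π (SmonNat I) ∈ admissibleSpan I.sum := by
  induction m with
  | zero => intro I h; omega
  | succ m ih =>
    intro I hm
    by_cases h0 : 0 ∈ I
    · obtain ⟨A, B, rfl⟩ := List.append_of_mem h0
      have e : SmonNat (A ++ 0 :: B) = SmonNat (A ++ B) := by
        rw [SmonNat_append, SmonNat_cons, S_zero, one_mul, SmonNat_append]
      have es : (A ++ 0 :: B).sum = (A ++ B).sum := by simp
      rw [e, es]
      apply ih
      simp only [moment_append, moment, List.length_append, List.length_cons, List.sum_cons,
        zero_add] at hm ⊢
      omega
    obtain ⟨K, rfl⟩ : ∃ K : List ℕ+, I = K.map fun i : ℕ+ => (i : ℕ) := by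
      have : I ∈ Set.range (List.map fun i : ℕ+ => (i : ℕ)) := by
        rw [Set.range_list_map]
        intro i hi
        exact ⟨⟨i, Nat.pos_of_ne_zero fun h => h0 (h ▸ hi)⟩, rfl⟩
      obtain ⟨K, hK⟩ := this
      exact ⟨K, hK.symm⟩
    by_cases hK : IsAdmissible K
    · rw [SmonNat_map, ← Sqmon_eq]
      exact Submodule.subset_span ⟨K, ⟨hK, rfl⟩, rfl⟩
    rw [IsAdmissible, List.isChain_iff_forall_rel_of_append_cons_cons] at hK
    push Not at hK
    obtain ⟨i, j, A, B, rfl, hij⟩ := hK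
    have hij' : (i : ℕ) < 2 * j := by exact_mod_cast hij
    simp only [List.map_append, List.map_cons] at hm ⊢
    generalize A.map (fun i : ℕ+ => (i : ℕ)) = A at hm ⊢
    generalize B.map (fun i : ℕ+ => (i : ℕ)) = B at hm ⊢
    rw [SmonNat_append, SmonNat_cons, SmonNat_cons, ← mul_assoc (S i), map_mul, map_mul, map_mul]
    rw [satisfiesAdem_π i j i.pos hij', sum_mul, mul_sum]
    refine sum_mem fun k hk => ?_
    have hk' : k ≤ (i : ℕ) / 2 := by rw [mem_range] at hk; omega
    rw [smul_mul_assoc, mul_smul_comm]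
    refine Submodule.smul_mem _ _ ?_
    have e : π (SmonNat A) * (π (S (i + j - k)) * π (S k) * π (SmonNat B)) =
        π (SmonNat (A ++ ((i : ℕ) + j - k) :: k :: B)) := by
      simp only [SmonNat_append, SmonNat_cons, map_mul, mul_assoc]
    have es : (A ++ (i : ℕ) :: (j : ℕ) :: B).sum = (A ++ ((i : ℕ) + j - k) :: k :: B).sum := by
      simp only [List.sum_append, List.sum_cons]
      omega
    rw [e, es]
    apply ih
    -- The total degree is preserved, so the moment changes only by the replacement of `j` by `k` in
    -- the second place, and `k ≤ i/2 < j`.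
    have e3 : (i : ℕ) + (j + B.sum) = (i + j - k) + (k + B.sum) := by omega
    simp only [moment_append, moment, List.length_append, List.length_cons, List.sum_cons] at hm ⊢
    rw [e3] at hm
    omega

theorem Sqmon_mem_admissibleSpan (I : List ℕ+) : Sqmon I ∈ admissibleSpan (deg I) := by
  have := π_SmonNat_mem_admissibleSpan _ (I.map fun i : ℕ+ => (i : ℕ)) (Nat.lt_succ_self _)
  rwa [SmonNat_map, ← Sqmon_eq] at this

theorem gradeA_eq_admissibleSpan (n : ℕ) : gradeA n = admissibleSpan n := by
  apply le_antisymm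
  · rw [gradeA, Submodule.span_le]
    rintro _ ⟨I, rfl, rfl⟩
    exact Sqmon_mem_admissibleSpan I
  · refine Submodule.span_mono (Set.image_mono fun J hJ => hJ.2)

theorem span_admissible :
    Submodule.span (ZMod 2) (Set.range fun J : Admissible => Sqmon J.1) = ⊤ := by
  rw [eq_top_iff]
  rintro x -
  obtain ⟨y, rfl⟩ := π_surjective x
  have hy : y ∈ Submodule.span (ZMod 2) (Set.range (FreeAlgebra.basisFreeMonoid (ZMod 2) ℕ+)) := by
    rw [Module.Basis.span_eq]; trivial
  induction hy using Submodule.span_induction with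
  | mem y hy =>
    obtain ⟨I, rfl⟩ := hy
    have e := basisFreeMonoid_eq (FreeMonoid.toList I)
    rw [FreeMonoid.ofList_toList] at e
    rw [e, ← Sqmon_eq]
    refine Submodule.span_mono ?_ (Sqmon_mem_admissibleSpan _)
    rintro _ ⟨J, hJ, rfl⟩
    exact ⟨⟨J, hJ.1⟩, rfl⟩
  | zero => simp
  | add a b _ _ ha hb => rw [map_add]; exact add_mem ha hb
  | smul r a _ ha => rw [map_smul]; exact Submodule.smul_mem _ _ ha

/-! ### Dual bases of graded duals -/

/-- The first entry is a positive `k ≤ N`, and the rest has degree at most `N - k < N`. -/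
theorem finite_setOf_deg_le (N : ℕ) : {I : List ℕ+ | deg I ≤ N}.Finite := by
  induction N using Nat.strong_induction_on with
  | _ N ih =>
    refine (((Set.finite_Iic N).biUnion fun k (_ : k ∈ Set.Iic N) =>
      (show {I : List ℕ+ | ∃ (i : ℕ+) (K : List ℕ+), I = i :: K ∧ (i : ℕ) = k ∧ i + deg K ≤ N}.Finite
        from ?_)).union (Set.finite_singleton [])).subset ?_
    · rcases Nat.eq_zero_or_pos k with rfl | hk
      · convert Set.finite_empty
        ext I
        simp only [Set.mem_ofPred_eq, Set.mem_empty_iff_false, iff_false]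
        rintro ⟨i, K, -, h, -⟩
        exact i.ne_zero h
      · rcases le_or_gt k N with hkN | hkN
        · refine ((ih (N - k) (by omega)).image (List.cons (k.toPNat hk))).subset ?_
          rintro _ ⟨i, K, rfl, h1, h2⟩
          refine ⟨K, ?_, ?_⟩
          · simp only [Set.mem_ofPred_eq]; omega
          · rw [show i = k.toPNat hk from PNat.eq h1]
        · convert Set.finite_empty
          ext I
          simp only [Set.mem_ofPred_eq, Set.mem_empty_iff_false, iff_false]
          rintro ⟨i, K, -, h, h'⟩
          omega
    · rintro (_ | ⟨i, K⟩) h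
      · exact Or.inr rfl
      · have h' : (i : ℕ) + deg K ≤ N := by simpa [deg] using h
        refine Or.inl ?_
        simp only [Set.mem_iUnion]
        exact ⟨i, by simp only [Set.mem_Iic]; omega, i, K, rfl, rfl, h'⟩

section DualBasis
variable {H : Type} [Ring H] [Bialgebra (ZMod 2) H] {𝒢 : ℕ → Submodule (ZMod 2) H}
  {h1 : ∀ n, 0 < n → ∀ x ∈ 𝒢 n, counit (R := ZMod 2) x = 0}
  {h2 : ∀ n, ∀ x ∈ 𝒢 n, comul (R := ZMod 2) x ∈ tensorGrade 𝒢 n}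

/-- A homogeneous basis with finitely many elements in bounded degrees has a dual basis of the
graded dual. -/
theorem exists_dualBasis {ι : Type} (b : Module.Basis ι (ZMod 2) H) (d : ι → ℕ)
    (hd : ∀ N, {i | d i ≤ N}.Finite)
    (hG : ∀ n, 𝒢 n = Submodule.span (ZMod 2) (b '' {i | d i = n})) :
    ∃ B : Module.Basis ι (ZMod 2) (gradedDual 𝒢 h1 h2),
      ∀ (f : gradedDual 𝒢 h1 h2) (i : ι), B.repr f i = f.1 (b i) := by
  classical
  have hfin : ∀ f : gradedDual 𝒢 h1 h2, (Function.support fun i => f.1 (b i)).Finite := by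
    rintro ⟨f, N, hN⟩
    refine (hd N).subset fun i hi => ?_
    by_contra h
    refine hi (hN (d i) (by simpa using h) _ ?_)
    rw [hG]
    exact Submodule.subset_span ⟨i, rfl, rfl⟩
  let toF : gradedDual 𝒢 h1 h2 →ₗ[ZMod 2] (ι →₀ ZMod 2) :=
    { toFun := fun f => Finsupp.ofSupportFinite _ (hfin f)
      map_add' := fun f g => by ext; rfl
      map_smul' := fun r f => by ext; rfl }
  have htoF : ∀ f i, toF f i = f.1 (b i) := fun f i => rfl
  have hbij : Function.Bijective toF := by
    constructor
    · intro f g hfg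
      refine Subtype.ext (WithConv.ext (b.ext fun i => ?_))
      have := DFunLike.congr_fun hfg i
      simpa only [htoF] using this
    · intro c
      let φ : H →ₗ[ZMod 2] ZMod 2 := b.constr (ZMod 2) c
      refine ⟨⟨toConv φ, c.support.sup d, fun n hn x hx => ?_⟩, ?_⟩
      · rw [hG] at hx
        induction hx using Submodule.span_induction with
        | mem x hx =>
          obtain ⟨i, rfl, rfl⟩ := hx
          refine (b.constr_basis (ZMod 2) c i).trans ?_
          by_contra h
          exact absurd (Finset.le_sup (f := d) (Finsupp.mem_support_iff.2 h)) (by omega)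
        | zero => exact map_zero φ
        | add a b _ _ ha hb => exact (map_add φ a b).trans (by
            rw [show φ a = 0 from ha, show φ b = 0 from hb, add_zero])
        | smul r a _ ha => exact (map_smul φ r a).trans (by
            rw [show φ a = 0 from ha, smul_zero])
      · ext i
        exact b.constr_basis (ZMod 2) c i
  exact ⟨Module.Basis.ofRepr (LinearEquiv.ofBijective toF hbij), fun f i => rfl⟩

/-- Products of functionals that vanish in degrees above `N` and `K` vanish above `N + K`. -/
theorem mul_vanish {f g : WithConv (H →ₗ[ZMod 2] ZMod 2)} {N K : ℕ}
    (h2 : ∀ n, ∀ x ∈ 𝒢 n, comul (R := ZMod 2) x ∈ tensorGrade 𝒢 n)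
    (hf : ∀ n, N < n → ∀ x ∈ 𝒢 n, f x = 0) (hg : ∀ n, K < n → ∀ x ∈ 𝒢 n, g x = 0) :
    ∀ n, N + K < n → ∀ x ∈ 𝒢 n, (f * g) x = 0 := by
  intro n hn x hx
  rw [LinearMap.convMul_apply]
  have h := h2 n x hx
  generalize comul (R := ZMod 2) x = z at h ⊢
  induction h using Submodule.span_induction with
  | mem t ht =>
    obtain ⟨p, q, y, z, hpq, hy, hz, rfl⟩ := ht
    rw [TensorProduct.map_tmul, LinearMap.mul'_apply]
    rcases le_or_gt p N with hp | hp
    · rw [hg q (by omega) z hz, mul_zero]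
    · rw [hf p hp y hy, zero_mul]
  | zero => simp
  | add a b _ _ ha hb => rw [map_add, map_add, ha, hb, add_zero]
  | smul r a _ ha => rw [map_smul, map_smul, ha, smul_zero]

end DualBasis

/-! ### Polynomial generators -/

theorem vanish_gradeF_of_Smon {f : WithConv (LeibnizHopf →ₗ[ZMod 2] ZMod 2)} {N : ℕ}
    (h : ∀ I, N < deg I → f (Smon I) = 0) : ∀ n, N < n → ∀ x ∈ gradeF n, f x = 0 := by
  intro n hn x hx
  induction hx using Submodule.span_induction with
  | mem x hx =>
    obtain ⟨I, rfl, rfl⟩ := hx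
    exact h I hn
  | zero => exact map_zero _
  | add a b _ _ ha hb => exact (map_add _ a b).trans (by rw [ha, hb, add_zero])
  | smul r a _ ha => exact (map_smul _ r a).trans (by rw [ha, smul_zero])

theorem sum_zipWith_add : ∀ {A B : List ℕ}, A.length = B.length →
    (List.zipWith (· + ·) A B).sum = A.sum + B.sum
  | [], [], _ => rfl
  | a :: A, b :: B, h => by
    have := sum_zipWith_add (A := A) (B := B) (by simpa using h)
    simp only [List.zipWith_cons_cons, List.sum_cons, this]
    ring

/-- The monomial in the `ξ̄ₙ` with exponents `γ(J)` vanishes in degrees above that of `J`. -/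
theorem monomialOf_ξbar_vanish (L : List ℕ) : ∀ n, (ofExcess L).sum < n → ∀ x ∈ gradeF n,
    (monomialOf ξbar L).1 x = 0 := by
  induction L using List.reverseRecOn with
  | nil =>
    intro n hn x hx
    rw [monomialOf_nil]
    have := counit_gradeF n (by simpa [ofExcess] using hn) x hx
    simpa using this
  | append_singleton L l ihL =>
    induction l with
    | zero =>
      rw [ofExcess_append_zero, monomialOf_append, pow_zero, mul_one]
      simpa using ihL
    | succ l ihl =>
      have e : (monomialOf ξbar (L ++ [l + 1])).1 =
          (monomialOf ξbar (L ++ [l])).1 * milnorFun (L.length + 1) := by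
        rw [monomialOf_append, pow_succ, ← mul_assoc, ← monomialOf_append]
        rfl
      rw [e, ofExcess_append_succ, sum_zipWith_add (by simp)]
      refine mul_vanish comul_gradeF ihl (vanish_gradeF_of_Smon fun I hI => ?_)
      rw [milnorFun_Smon, if_neg]
      rintro rfl
      rw [deg_eq_sum, map_milnorSeq] at hI
      exact lt_irrefl _ hI

theorem monomialOf_ξbar_excess_self {J : List ℕ+} (hJ : IsAdmissible J) :
    (monomialOf ξbar (excess J)).1 (Smon J) = 1 := by
  rw [← SmonNat_map]
  exact (monomialOf_ξbar_triangular _ _ (by simp [length_excess])).1 (ofExcess_excess hJ).symm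

/-- Longer words are larger by definition and equal lengths are the triangularity above. A shorter
word is padded with `S⁰` to the length of `J`, and then its last entry is too small. -/
theorem eq_or_rLexLT_of_monomialOf_ξbar_ne_zero {I J : List ℕ+} (hJ : IsAdmissible J)
    (h : (monomialOf ξbar (excess J)).1 (Smon I) ≠ 0) : I = J ∨ RLexLT J I := by
  rcases lt_trichotomy J.length I.length with hl | hl | hl
  · exact Or.inr (Or.inl hl)
  · rw [← SmonNat_map] at h
    have := (monomialOf_ξbar_triangular _ _ (by simp [length_excess, hl])).2 h
    rw [ofExcess_excess hJ] at this
    exact this.imp (fun h => (List.map_injective_iff.2 PNat.coe_injective) h) rLexLT_of_rLt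
  · exfalso
    obtain ⟨m, hm⟩ := Nat.exists_eq_add_of_lt hl
    have e : Smon I = SmonNat (I.map (fun i : ℕ+ => (i : ℕ)) ++ List.replicate m 0 ++ [0]) := by
      rw [← SmonNat_map]
      simp [SmonNat]
    rw [e] at h
    have := (monomialOf_ξbar_triangular _ _ (by simp [length_excess, hm, add_assoc])).2 h
    rw [ofExcess_excess hJ] at this
    obtain ⟨K, j, rfl⟩ : ∃ K j, J = K ++ [j] := by
      rcases List.eq_nil_or_concat J with rfl | ⟨K, i, h⟩
      · simp at hl
      · exact ⟨K, i, by simpa using h⟩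
    have hlen : I.length + m = K.length := by simp at hm; omega
    rw [List.map_append, List.map_singleton, RLt.append_singleton_iff (by simp [hlen])] at this
    -- The padded word ends in 0 and `J` in `j > 0`, so the padded word is neither equal to `J` nor
    -- larger.
    have hj := j.pos
    rcases this with h | h | h
    · have := List.append_inj_right' h rfl
      simp only [List.cons.injEq, and_true] at this
      omega
    · omega
    · omega

theorem exists_minimal_of_finite {α : Type} (r : α → α → Prop) [IsStrictOrder α r] {s : Set α}
    (hs : s.Finite) (hne : s.Nonempty) : ∃ m ∈ s, ∀ x ∈ s, ¬ r x m := by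
  obtain ⟨x, hx⟩ := hne
  obtain ⟨⟨m, hm⟩, -, h⟩ := WellFounded.has_min (hs.wellFoundedOn (r := r)) Set.univ ⟨⟨x, hx⟩, trivial⟩
  exact ⟨m, hm, fun y hy => h ⟨y, hy⟩ trivial⟩

theorem isStrictOrder_rLt : IsStrictOrder (List ℕ) RLt :=
  { irrefl := RLt.irrefl, trans := fun _ _ _ => RLt.trans }

theorem isStrictOrder_rLexGT : IsStrictOrder Admissible fun K J => RLexLT J.1 K.1 :=
  { irrefl := fun J => RLexLT.irrefl J.1, trans := fun _ _ _ h h' => h'.trans h }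

/-- Evaluation of functionals at a point. -/
noncomputable def evalAt (y : LeibnizHopf) : LeibnizHopfDual →ₗ[ZMod 2] ZMod 2 where
  toFun f := f.1 y
  map_add' _ _ := rfl
  map_smul' _ _ := rfl

/-- In a polynomial relation, take the monomial with the smallest leading word and evaluate there:
every other monomial vanishes on it, so its coefficient is 0. -/
theorem algebraicIndependent_ξbar : AlgebraicIndependent (ZMod 2) ξbar := by
  rw [algebraicIndependent_iff]
  intro p hp
  by_contra hne
  obtain ⟨n, hn⟩ : ∃ n, ∀ m ∈ p.support, m.support ⊆ range n := by
    obtain ⟨n, hn⟩ := (p.support.biUnion fun m => m.support).exists_nat_subset_range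
    exact ⟨n, fun m hm => (Finset.subset_biUnion_of_mem (fun m : ℕ →₀ ℕ => m.support) hm).trans hn⟩
  -- Exponent vectors are written with a common length `n`, possibly with trailing zeros, because
  -- leading words are compared only at equal length.
  let E : (ℕ →₀ ℕ) → List ℕ := fun m => (List.range n).map m
  have hE : ∀ m ∈ p.support, m.prod (fun i k => ξbar i ^ k) = monomialOf ξbar (E m) := by
    intro m hm
    rw [Finsupp.prod_of_support_subset m (hn m hm) _ (by simp), monomialOf_eq_prod_range]
    simp only [E, List.length_map, List.length_range]
    refine prod_congr rfl fun k hk => ?_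
    simp [mem_range.1 hk]
  have hinj : ∀ m ∈ p.support, ∀ m' ∈ p.support, E m = E m' → m = m' := by
    intro m hm m' hm' h
    ext k
    by_cases hk : k ∈ range n
    · exact List.map_inj_left.1 h k (by simpa using hk)
    · rw [Finsupp.notMem_support_iff.1 fun h => hk (hn m hm h),
        Finsupp.notMem_support_iff.1 fun h => hk (hn m' hm' h)]
  have := isStrictOrder_rLt
  obtain ⟨_, ⟨m, hm, rfl⟩, hmin⟩ := exists_minimal_of_finite RLt
    (p.support.finite_toSet.image fun m => ofExcess (E m))
    ((Finset.coe_nonempty.2 (MvPolynomial.support_nonempty.2 hne)).image _)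
  have hm' : m ∈ p.support := hm
  have h0 : evalAt (SmonNat (ofExcess (E m))) (MvPolynomial.aeval ξbar p) = 0 := by
    rw [hp, map_zero]
  rw [MvPolynomial.as_sum p, map_sum, map_sum, Finset.sum_eq_single m] at h0
  · rw [MvPolynomial.aeval_monomial, hE m hm', ← Algebra.smul_def, map_smul] at h0
    have h1 := (monomialOf_ξbar_triangular (E m) _ (by simp)).1 rfl
    rw [show evalAt (SmonNat (ofExcess (E m))) (monomialOf ξbar (E m)) = 1 from h1, smul_eq_mul,
      mul_one] at h0
    exact MvPolynomial.mem_support_iff.1 hm' h0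
  · intro k hk hkm
    rw [MvPolynomial.aeval_monomial, hE k hk, ← Algebra.smul_def, map_smul]
    refine smul_eq_zero_of_right _ ?_
    by_contra h
    rcases (monomialOf_ξbar_triangular (E k) _ (by simp [E])).2 h with h | h
    · exact hkm (hinj _ hk _ hm' (ofExcess_injective h).symm)
    · exact hmin _ ⟨k, hk, rfl⟩ h
  · exact fun h => absurd hm' h

/-! ### The generators of the dual Steenrod algebra and the map `π*` -/

/-- The elements `ξₙ₊₁`, defined by the action of `𝓐₂` on the span of the `x^{2ᵏ}`. -/
noncomputable def ξ (n : ℕ) : SteenrodDual :=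
  ⟨toConv (milnorFunA (n + 1)), deg (milnorSeq (n + 1)), fun k hk x hx => by
    induction hx using Submodule.span_induction with
    | mem x hx =>
      obtain ⟨I, rfl, rfl⟩ := hx
      refine (milnorFunA_Sqmon _ _).trans (if_neg ?_)
      rintro rfl
      exact lt_irrefl _ hk
    | zero => exact map_zero _
    | add a b _ _ ha hb => exact (map_add _ a b).trans (by rw [ha, hb, add_zero])
    | smul r a _ ha => exact (map_smul _ r a).trans (by rw [ha, smul_zero])⟩

theorem πDual_apply_Smon (f : SteenrodDual) (I : List ℕ+) :
    (πDual f).1 (Smon I) = f.1 (Sqmon I) := by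
  rw [Sqmon_eq]
  rfl

theorem πDual_ξ (n : ℕ) : πDual (ξ n) = ξbar n := by
  refine Subtype.ext (withConv_ext_Smon fun I => ?_)
  rw [πDual_apply_Smon]
  exact (milnorFunA_Sqmon _ _).trans (Sdual_Smon _ _).symm

theorem πDual_injective : Function.Injective πDual := by
  intro f g h
  refine Subtype.ext (WithConv.ext (LinearMap.ext fun x => ?_))
  obtain ⟨y, rfl⟩ := π_surjective x
  exact congrArg (fun f : LeibnizHopfDual => f.1 y) h

theorem πDual_monomialOf (L : List ℕ) : πDual (monomialOf ξ L) = monomialOf ξbar L := by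
  have := map_monomialOf (R := SteenrodDual) (T := LeibnizHopfDual) (πDual : _ →+* _) ξ L
  refine this.trans ?_
  rw [← show (fun k => πDual (ξ k)) = ξbar from funext πDual_ξ]
  rfl

theorem monomialOf_ξ_apply (L : List ℕ) (I : List ℕ+) :
    (monomialOf ξ L).1 (Sqmon I) = (monomialOf ξbar L).1 (Smon I) := by
  rw [← πDual_apply_Smon, πDual_monomialOf]

/-- Apply `ξ^{γ(J)}` to a linear relation, with `J` the right lexicographically largest sequence
occurring in it. Only `Sq^J` survives, with value 1. -/
theorem linearIndependent_admissible :
    LinearIndependent (ZMod 2) (fun J : Admissible => Sqmon J.1) := by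
  rw [linearIndependent_iff']
  intro s g hg i hi
  by_contra hgi
  have := isStrictOrder_rLexGT
  obtain ⟨J, ⟨hJs, hJ⟩, hmax⟩ := exists_minimal_of_finite
    (fun K J : Admissible => RLexLT J.1 K.1) (s := {J | J ∈ s ∧ g J ≠ 0})
    (s.finite_toSet.subset fun J h => h.1) ⟨i, hi, hgi⟩
  have h0 := congrArg (monomialOf ξ (excess J.1)).1.ofConv hg
  rw [map_sum, map_zero, Finset.sum_eq_single J] at h0
  · rw [map_smul] at h0
    have h1 : (monomialOf ξ (excess J.1)).1.ofConv (Sqmon J.1) = 1 :=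
      (monomialOf_ξ_apply _ _).trans (monomialOf_ξbar_excess_self J.2)
    rw [h1, smul_eq_mul, mul_one] at h0
    exact hJ h0
  · intro K hK hKJ
    rw [map_smul]
    by_contra h
    have hgK := left_ne_zero_of_smul h
    have h1 := right_ne_zero_of_smul h
    rw [show (monomialOf ξ (excess J.1)).1.ofConv (Sqmon K.1) = _ from monomialOf_ξ_apply _ _] at h1
    rcases eq_or_rLexLT_of_monomialOf_ξbar_ne_zero J.2 h1 with h2 | h2
    · exact hKJ (Subtype.ext h2)
    · exact hmax K ⟨hK, hgK⟩ h2
  · exact fun h => absurd hJs h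

/-! ### The admissible basis and the dual bases -/

/-- The basis of admissible monomials. -/
noncomputable def admissibleBasis : Module.Basis Admissible (ZMod 2) SteenrodAlgebra :=
  Module.Basis.mk linearIndependent_admissible span_admissible.ge

theorem admissibleBasis_apply (J : Admissible) : admissibleBasis J = Sqmon J.1 := by
  simp [admissibleBasis]

theorem exists_basis_SteenrodDual : ∃ B : Module.Basis Admissible (ZMod 2) SteenrodDual,
    ∀ (f : SteenrodDual) (J : Admissible), B.repr f J = f.1 (Sqmon J.1) := by
  obtain ⟨B, hB⟩ := exists_dualBasis (h1 := counit_gradeA) (h2 := comul_gradeA) admissibleBasis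
    (fun J => deg J.1)
    (fun N => (finite_setOf_deg_le N).preimage Subtype.val_injective.injOn) (fun n => by
      rw [gradeA_eq_admissibleSpan, admissibleSpan]
      congr 1
      ext x
      constructor
      · rintro ⟨J, ⟨h, h'⟩, rfl⟩
        exact ⟨⟨J, h⟩, h', admissibleBasis_apply _⟩
      · rintro ⟨J, h, rfl⟩
        exact ⟨J.1, ⟨J.2, h⟩, (admissibleBasis_apply _).symm⟩)
  exact ⟨B, fun f J => by rw [hB, admissibleBasis_apply]⟩

theorem exists_basis_LeibnizHopfDual : ∃ B : Module.Basis (List ℕ+) (ZMod 2) LeibnizHopfDual,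
    (∀ I, B I = Sdual I) ∧
    ∀ (f : LeibnizHopfDual) (I : List ℕ+), B.repr f I = f.1 (Smon I) := by
  let b : Module.Basis (List ℕ+) (ZMod 2) LeibnizHopf :=
    (FreeAlgebra.basisFreeMonoid (ZMod 2) ℕ+).reindex FreeMonoid.toList
  have hb : ∀ I, b I = Smon I := fun I => by
    rw [← basisFreeMonoid_eq]
    exact Module.Basis.reindex_apply _ _ _
  obtain ⟨B, hB⟩ := exists_dualBasis (h1 := counit_gradeF) (h2 := comul_gradeF) b deg
    finite_setOf_deg_le (fun n => by rw [gradeF, show ⇑b = Smon from funext hb])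
  have hB' : ∀ (f : LeibnizHopfDual) (I : List ℕ+), B.repr f I = f.1 (Smon I) :=
    fun f I => by rw [hB, hb]
  refine ⟨B, fun I => B.repr.injective (Finsupp.ext fun K => ?_), hB'⟩
  rw [hB' (Sdual I), Sdual_Smon, Module.Basis.repr_self, Finsupp.single_apply]
  simp only [eq_comm]

/-! ### Leading terms of monomials, generation and the image of `π*` -/

theorem monomialOf_ξbar_sub_mem (J : Admissible) :
    monomialOf ξbar (excess J.1) - Sdual J.1 ∈
      Submodule.span (ZMod 2) (Sdual '' {I | RLexLT J.1 I}) := by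
  obtain ⟨B, hBS, hB⟩ := exists_basis_LeibnizHopfDual
  rw [← show ⇑B = Sdual from funext hBS, Module.Basis.mem_span_image]
  intro I hI
  have e : B.repr (monomialOf ξbar (excess J.1) - B J.1) I =
      (monomialOf ξbar (excess J.1)).1 (Smon I) - if J.1 = I then 1 else 0 := by
    rw [hB, ← Finsupp.single_apply, ← B.repr_self, hB]
    rfl
  rw [Finset.mem_coe, Finsupp.mem_support_iff, e] at hI
  rcases eq_or_ne I J.1 with rfl | hne
  · rw [if_pos rfl, monomialOf_ξbar_excess_self J.2, sub_self] at hI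
    exact absurd rfl hI
  · rw [if_neg hne.symm, sub_zero] at hI
    exact (eq_or_rLexLT_of_monomialOf_ξbar_ne_zero J.2 hI).resolve_left hne

/-- The degree bound leaves only finitely many `K`, whereas infinitely many admissible sequences
exceed `J`. Generation by the `ξₙ` depends on it. -/
theorem monomialOf_ξ_sub_mem_deg_le {B : Module.Basis Admissible (ZMod 2) SteenrodDual}
    (hB : ∀ (f : SteenrodDual) (J : Admissible), B.repr f J = f.1 (Sqmon J.1))
    (J : Admissible) : monomialOf ξ (excess J.1) - B J ∈
    Submodule.span (ZMod 2) (B '' {K | RLexLT J.1 K.1 ∧ deg K.1 ≤ deg J.1}) := by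
  rw [Module.Basis.mem_span_image]
  intro K hK
  have e : B.repr (monomialOf ξ (excess J.1) - B J) K =
      (monomialOf ξbar (excess J.1)).1 (Smon K.1) - if J = K then 1 else 0 := by
    rw [hB, ← Finsupp.single_apply, ← B.repr_self, hB, ← monomialOf_ξ_apply]
    rfl
  rw [Finset.mem_coe, Finsupp.mem_support_iff, e] at hK
  rcases eq_or_ne K J with rfl | hne
  · rw [if_pos rfl, monomialOf_ξbar_excess_self K.2, sub_self] at hK
    exact absurd rfl hK
  · rw [if_neg hne.symm, sub_zero] at hK
    refine ⟨(eq_or_rLexLT_of_monomialOf_ξbar_ne_zero J.2 hK).resolve_left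
      fun h => hne (Subtype.ext h), ?_⟩
    by_contra h
    refine hK (monomialOf_ξbar_vanish _ _ ?_ _ (Smon_mem K.1))
    rw [ofExcess_excess J.2, ← deg_eq_sum]
    omega

theorem dualBasis_milnorSeq {B : Module.Basis Admissible (ZMod 2) SteenrodDual}
    (hB : ∀ (f : SteenrodDual) (J : Admissible), B.repr f J = f.1 (Sqmon J.1)) (n : ℕ) :
    ξ n = B ⟨milnorSeq (n + 1), isAdmissible_milnorSeq (n + 1)⟩ := by
  refine B.repr.injective (Finsupp.ext fun K => ?_)
  rw [hB, Module.Basis.repr_self, Finsupp.single_apply]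
  refine (milnorFunA_Sqmon _ _).trans ?_
  simp only [Subtype.ext_iff, eq_comm]

/-- Descending right lexicographic induction inside the finite set of admissible sequences of degree
at most `N`: `Sq_J` is `ξ^{γ(J)}` minus a combination of larger `Sq_K` in the same set. -/
theorem adjoin_ξ {B : Module.Basis Admissible (ZMod 2) SteenrodDual}
    (hB : ∀ (f : SteenrodDual) (J : Admissible), B.repr f J = f.1 (Sqmon J.1)) :
    Algebra.adjoin (ZMod 2) (Set.range ξ) = ⊤ := by
  have key : ∀ N, ∀ J : Admissible, J ∈ {J : Admissible | deg J.1 ≤ N} →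
      B J ∈ Subalgebra.toSubmodule (Algebra.adjoin (ZMod 2) (Set.range ξ)) := by
    intro N J hJ
    have := isStrictOrder_rLexGT
    have hfin : {J : Admissible | deg J.1 ≤ N}.Finite :=
      (finite_setOf_deg_le N).preimage Subtype.val_injective.injOn
    refine (hfin.wellFoundedOn (r := fun K J : Admissible => RLexLT J.1 K.1)).induction
      (P := fun J => B J ∈ Subalgebra.toSubmodule (Algebra.adjoin (ZMod 2) (Set.range ξ))) hJ ?_
    intro J hJ ih
    have h1 : monomialOf ξ (excess J.1) ∈ Algebra.adjoin (ZMod 2) (Set.range ξ) :=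
      Subalgebra.prod_mem _ fun k _ =>
        Subalgebra.pow_mem _ (Algebra.subset_adjoin (Set.mem_range_self _)) _
    have h2 : monomialOf ξ (excess J.1) - B J ∈
        Subalgebra.toSubmodule (Algebra.adjoin (ZMod 2) (Set.range ξ)) := by
      refine Submodule.span_le.2 ?_ (monomialOf_ξ_sub_mem_deg_le hB J)
      rintro _ ⟨K, ⟨hK, hKd⟩, rfl⟩
      exact ih K (hKd.trans hJ) hK
    have e : B J = monomialOf ξ (excess J.1) + (-1 : ZMod 2) • (monomialOf ξ (excess J.1) - B J) := by
      refine Subtype.ext (WithConv.ext (LinearMap.ext fun y => ?_))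
      change (B J).1 y = (monomialOf ξ (excess J.1)).1 y +
        (-1) * ((monomialOf ξ (excess J.1)).1 y - (B J).1 y)
      ring
    rw [e]
    exact Submodule.add_mem _ h1 (Submodule.smul_mem _ _ h2)
  rw [← Algebra.toSubmodule_eq_top, eq_top_iff, ← B.span_eq, Submodule.span_le]
  rintro _ ⟨J, rfl⟩
  exact key (deg J.1) J (le_refl (deg J.1))

theorem range_πDual : πDual.range = Algebra.adjoin (ZMod 2) (Set.range ξbar) := by
  obtain ⟨B, hB⟩ := exists_basis_SteenrodDual
  rw [← Algebra.map_top, ← adjoin_ξ hB, AlgHom.map_adjoin, ← Set.range_comp]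
  congr 2
  exact funext πDual_ξ

theorem algebraicIndependent_ξ : AlgebraicIndependent (ZMod 2) ξ := by
  refine AlgebraicIndependent.of_comp (A := SteenrodDual) (A' := LeibnizHopfDual) πDual ?_
  rw [show πDual ∘ ξ = ξbar from funext πDual_ξ]
  exact algebraicIndependent_ξbar

end Steenrod

theorem theorem3p3 :
    -- the admissible monomials form a basis of the Steenrod algebra
    LinearIndependent (ZMod 2) (fun J : Steenrod.Admissible => Steenrod.Sqmon J.1) ∧
    Submodule.span (ZMod 2)
      (Set.range fun J : Steenrod.Admissible => Steenrod.Sqmon J.1) = ⊤ ∧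
    -- and `Sq_J` is the basis of the graded dual that is dual to it
    ∃ Sq_ : Module.Basis Steenrod.Admissible (ZMod 2) Steenrod.SteenrodDual,
      (∀ J K : Steenrod.Admissible,
        (Sq_ J).1 (Steenrod.Sqmon K.1) = if K = J then 1 else 0) ∧
      -- `ξ n` stands for `ξ_{n+1}`, and `ξbar n` for `S_{2^n, …, 2, 1}`
      ∃ (ξ : ℕ → Steenrod.SteenrodDual) (ξbar : ℕ → Steenrod.LeibnizHopfDual),
        (∀ n, ξ n = Sq_ ⟨Steenrod.milnorSeq (n + 1), Steenrod.isAdmissible_milnorSeq (n + 1)⟩) ∧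
        (∀ n, ξbar n = Steenrod.Sdual (Steenrod.milnorSeq (n + 1))) ∧
        -- `π*` is injective and maps `ξ_n` to `ξbar_n`
        Function.Injective Steenrod.πDual ∧
        (∀ n, Steenrod.πDual (ξ n) = ξbar n) ∧
        -- the image of `π*` is the polynomial algebra on the `ξbar_n`
        Steenrod.πDual.range = Algebra.adjoin (ZMod 2) (Set.range ξbar) ∧
        AlgebraicIndependent (ZMod 2) ξbar ∧
        (∀ J : Steenrod.Admissible,
          Steenrod.monomialOf ξbar (Steenrod.excess J.1) - Steenrod.Sdual J.1 ∈
            Submodule.span (ZMod 2) (Steenrod.Sdual '' {I | Steenrod.RLexLT J.1 I})) ∧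
        -- the dual Steenrod algebra is the polynomial algebra on the `ξ_n`
        Algebra.adjoin (ZMod 2) (Set.range ξ) = ⊤ ∧
        AlgebraicIndependent (ZMod 2) ξ ∧
        (∀ J : Steenrod.Admissible,
          Steenrod.monomialOf ξ (Steenrod.excess J.1) - Sq_ J ∈
            Submodule.span (ZMod 2) (Sq_ '' {K | Steenrod.RLexLT J.1 K.1})) := by
  obtain ⟨B, hB⟩ := Steenrod.exists_basis_SteenrodDual
  refine ⟨Steenrod.linearIndependent_admissible, Steenrod.span_admissible, B, fun J K => ?_,
    Steenrod.ξ, Steenrod.ξbar, Steenrod.dualBasis_milnorSeq hB, fun _ => rfl,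
    Steenrod.πDual_injective, Steenrod.πDual_ξ, Steenrod.range_πDual,
    Steenrod.algebraicIndependent_ξbar, Steenrod.monomialOf_ξbar_sub_mem, Steenrod.adjoin_ξ hB,
    Steenrod.algebraicIndependent_ξ, fun J => ?_⟩
  · rw [← hB, Module.Basis.repr_self, Finsupp.single_apply]
    simp only [eq_comm]
  -- The degree bound has served its purpose in the proof of generation and is dropped.
  · exact Submodule.span_mono (Set.image_mono fun K hK => hK.1)
      (Steenrod.monomialOf_ξ_sub_mem_deg_le hB J)
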